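/- \textbf{The group.} Let $G$ be $O(p,q)$ with $p+q=2n+1$, or $Sp_{2n}(\mathbb R)$. Let $V=\mathbb C^N$ be its defining module ($N=p+q$, respectively $N=2n$), $J$ the Gram matrix of the invariant bilinear form, $J=\mathrm{diag}(I_p,-I_q)$, respectively $J=\begin{pmatrix}0&I_n\\-I_n&0\end{pmatrix}$, and put $\varepsilon=1$, respectively $\varepsilon=-1$, so that $J^{T}=\varepsilon J$. Let $K=G\cap O(N)$ be the maximal compact subgroup, $\mathfrak g_0=\mathfrak k_0\oplus\mathfrak p_0$ the Cartan decomposition of the real Lie algebra, $\mathfrak g$ the complexification of $\mathfrak g_0$, and $g^*=-\overline g$ for $g\in\mathfrak g$ (conjugation with respect to $\mathfrak g_0$). Let $\xi=J$, respectively $\xi=iJ$; then $\xi^2=1$ and conjugation by $\xi$ is the Cartan involution. Let $X$ be a $(\mathfrak g,K)$-module (for example a Harish-Chandra module), let $k\ge 0$, and let $\mu:K\to\mathbb C^\times$ be a character. \textbf{The algebra.} Let $\mathfrak B_k^\theta$ be the type $B/C$ VW-algebra with parameters $m_0=\varepsilon N$ and $m_1=\mathrm{tr}\,\xi$ (so $(m_0,m_1)=(p+q,\,p-q)$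 for $O(p,q)$ and $(-2n,0)$ for $Sp_{2n}(\mathbb R)$): the complex associative unital algebra with generators $t_{i,i+1},e_{i,i+1}$ ($1\le i<k$) and $z_i,\theta_i$ ($1\le i\le k$), subject to the following relations. \begin{itemize} \item The $t_{i,i+1}$ and $\theta_i$ satisfy the relations of the hyperoctahedral group $W(B_k)$: the $t_{i,i+1}$ satisfy the Coxeter relations of $S_k$, $\theta_i^2=1$, $\theta_i\theta_j=\theta_j\theta_i$, $t_{i,i+1}\theta_it_{i,i+1}=\theta_{i+1}$, and $[t_{i,i+1},\theta_j]=0$ for $j\ne i,i+1$. \item $e_{i,i+1}^2=m_0e_{i,i+1}$; $t_{i,i+1}e_{i,i+1}=e_{i,i+1}=e_{i,i+1}t_{i,i+1}$; $t_{i,i+1}t_{i+1,i+2}e_{i,i+1}t_{i+1,i+2}t_{i,i+1}=e_{i+1,i+2}$; $e_{i,i+1}t_{i+1,i+2}e_{i,i+1}=e_{i,i+1}$; and $[t_{i,i+1},e_{j,j+1}]=[e_{i,i+1},e_{j,j+1}]=0$ for $|i-j|>1$. \item $[z_i,z_j]=0$; $t_{i,i+1}z_i-z_{i+1}t_{i,i+1}=e_{i,i+1}-1$;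 $e_{i,i+1}(z_i+z_{i+1})=0=(z_i+z_{i+1})e_{i,i+1}$; and $[t_{i,i+1},z_j]=[e_{i,i+1},z_j]=0$ for $j\ne i,i+1$. \item $e_{12}z_1^le_{12}=w\,e_{12}$ for each $(l,w)$ in a set $\mathcal W\subset\mathbb Z_{\ge0}\times\mathbb R$. \item $[e_{i,i+1},\theta_j]=0$ for $j\ne i,i+1$; $e_{i,i+1}\theta_i\theta_{i+1}=\varepsilon e_{i,i+1}=\theta_i\theta_{i+1}e_{i,i+1}$; $e_{i,i+1}\theta_ie_{i,i+1}=m_1e_{i,i+1}$; and $[\theta_k,z_j]=0$ for $j\ne k$. \end{itemize} The set $\mathcal W$ is arbitrary (possibly empty), subject only to the condition that the relations $e_{12}z_1^le_{12}=w\,e_{12}$ with $(l,w)\in\mathcal W$ hold for the operators on $X\otimes V^{\otimes k}$ given below. \textbf{The action.} Number the factors of $X\otimes V^{\otimes k}$ by $0,1,\dots,k$ and write $(a)_i$ for $a$ acting on the $i$-th factor. Let $\Omega_{ij}=\sum_b(b)_i(b^*)_j$, where $b$ runs over a basis of $\mathfrak g$ and $b^*$ over the dual basis for the form $\tfrac12\mathrm{tr}(xy)$.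 Then $\mathfrak B_k^\theta$ acts on $X\otimes V^{\otimes k}$, commuting with $K$, by $$z_i\mapsto\varepsilon\Big(\sum_{0\le j<i}\Omega_{ji}+\tfrac{N-\varepsilon}2\Big),\qquad t_{i,i+1}\mapsto\varepsilon s_{i,i+1},\qquad e_{i,i+1}\mapsto\varepsilon N\,\mathrm{pr}_{i,i+1},\qquad\theta_i\mapsto(\xi)_i,$$ where $s_{i,i+1}$ exchanges two factors $V$ and $\mathrm{pr}_{i,i+1}$ is the projection of $V_i\otimes V_{i+1}$ onto its trivial $G$-submodule. Hence $\mathfrak B_k^\theta$ acts on $F_{\mu,k}(X)=\mathrm{Hom}_K(\mu,X\otimes V^{\otimes k})$. Let $\bullet$ be the conjugate linear antihomomorphism of $\mathfrak B_k^\theta$ that fixes every $z_i,t_{i,i+1},\theta_i,e_{i,i+1}$, let $w_0=\theta_1\theta_2\cdots\theta_k$, and $b^*=w_0b^\bullet w_0$. \textbf{Forms.} Sesquilinear forms are linear in the first and conjugate linear in the second variable; a Hermitian form is a sesquilinear form with $\langle x,y\rangle=\overline{\langle y,x\rangle}$. A form on $X$ is $*$-invariant if $\langle gx,y\rangle=\langle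 x,g^*y\rangle$ for $g\in\mathfrak g$; a form on a $\mathfrak B_k^\theta$-module is $*$-invariant if $\langle bx,y\rangle=\langle x,b^*y\rangle$ for $b\in\mathfrak B_k^\theta$. A module is unitary if it has a positive definite $*$-invariant Hermitian form. Call a non-degenerate sesquilinear form on $V$ compatible if $\langle\kappa v,w\rangle=\langle v,\kappa^{-1}w\rangle$ for $\kappa\in K$ and $\langle Pv,w\rangle=\langle v,Pw\rangle$ for $P\in\mathfrak p_0$. Given forms on $X$ and $V$, the induced form on $F_{\mu,k}(X)$ is $\langle\phi,\psi\rangle=\langle\phi(1),\psi(1)\rangle_{X\otimes V^{\otimes k}}$, where $$\langle x\otimes v_1\otimes\cdots\otimes v_k,\;x'\otimes v_1'\otimes\cdots\otimes v_k'\rangle_{X\otimes V^{\otimes k}}=\langle x,x'\rangle_X\prod_{i=1}^k\langle v_i,v_i'\rangle_V .$$ \textbf{Statement.} \begin{enumerate} \item Compatible Hermitian forms on $V$ exist. For every compatible form on $V$ and every $*$-invariant sesquilinear form on $X$, the induced form on $F_{\mu,k}(X)$ is $*$-invariant, and it is Hermitian if the forms on $X$ and $V$ are Hermitian. In particular, if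 $X$ carries a $*$-invariant Hermitian form, then the induced form is a $*$-invariant Hermitian form on $F_{\mu,k}(X)$. \item If $X$ is unitary, then $F_{\mu,k}(X)$ is a unitary $\mathfrak B_k^\theta$-module. \end{enumerate} -/

import Mathlib

open scoped TensorProduct ComplexConjugate
open Matrix

attribute [local instance] LieRing.ofAssociativeRing

/-- The real groups under consideration: `O(p,q)` with `p + q = 2n + 1`, and `Sp(2n, ℝ)`. -/
inductive ClassicalGroup : Type
  | O (p q n : ℕ) (h : p + q = 2 * n + 1)
  | Sp (n : ℕ)

namespace ClassicalGroup

abbrev left : ClassicalGroup → ℕ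
  | O p _ _ _ => p
  | Sp n => n

abbrev right : ClassicalGroup → ℕ
  | O _ q _ _ => q
  | Sp n => n

/-- The index set of the standard basis of the defining module. -/
abbrev Idx (G : ClassicalGroup) : Type := Fin G.left ⊕ Fin G.right

/-- `N = dim V`. -/
def dim (G : ClassicalGroup) : ℕ := G.left + G.right

/-- The Gram matrix of the invariant bilinear form: `diag(1,…,1,-1,…,-1)` for `O(p,q)`, and
`[[0, 1], [-1, 0]]` for `Sp(2n, ℝ)`. -/
def J : (G : ClassicalGroup) → Matrix G.Idx G.Idx ℝ
  | O _ _ _ _ => fromBlocks 1 0 0 (-1)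
  | Sp _ => fromBlocks 0 1 (-1) 0

/-- `+1` for orthogonal groups and `-1` for symplectic groups. -/
def eps : ClassicalGroup → ℝ
  | O _ _ _ _ => 1
  | Sp _ => -1

/-- The group `G = {A : Aᵀ J A = J}`. -/
def group (G : ClassicalGroup) : Subgroup (GL G.Idx ℝ) where
  carrier := {A | (A : Matrix G.Idx G.Idx ℝ)ᵀ * G.J * (A : Matrix G.Idx G.Idx ℝ) = G.J}
  one_mem' := by simp
  mul_mem' := by
    intro A B hA hB
    simp only [Set.mem_ofPred_eq] at hA hB ⊢
    calc _ = (B : Matrix G.Idx G.Idx ℝ)ᵀ *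
          ((A : Matrix G.Idx G.Idx ℝ)ᵀ * G.J * (A : Matrix G.Idx G.Idx ℝ)) * B := by
          simp [Matrix.transpose_mul, Matrix.mul_assoc]
      _ = _ := by rw [hA, hB]
  inv_mem' := by
    intro A hA
    simp only [Set.mem_ofPred_eq] at hA ⊢
    have h1 : (A : Matrix G.Idx G.Idx ℝ) * ((A⁻¹ : GL G.Idx ℝ) : Matrix G.Idx G.Idx ℝ) = 1 := by
      rw [← Units.val_mul, mul_inv_cancel, Units.val_one]
    have h2 : ((A⁻¹ : GL G.Idx ℝ) : Matrix G.Idx G.Idx ℝ)ᵀ * (A : Matrix G.Idx G.Idx ℝ)ᵀ = 1 := by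
      rw [← Matrix.transpose_mul, h1, Matrix.transpose_one]
    conv_lhs => rw [← hA]
    calc _ = (((A⁻¹ : GL G.Idx ℝ) : Matrix G.Idx G.Idx ℝ)ᵀ * (A : Matrix G.Idx G.Idx ℝ)ᵀ) * G.J *
          ((A : Matrix G.Idx G.Idx ℝ) * ((A⁻¹ : GL G.Idx ℝ) : Matrix G.Idx G.Idx ℝ)) := by
          simp only [Matrix.mul_assoc]
      _ = _ := by rw [h1, h2]; simp

/-- The maximal compact subgroup `K`: the fixed points of `A ↦ (Aᵀ)⁻¹` in `G`. -/
def K (G : ClassicalGroup) : Subgroup (GL G.Idx ℝ) where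
  carrier := {A | A ∈ G.group ∧ (A : Matrix G.Idx G.Idx ℝ)ᵀ * (A : Matrix G.Idx G.Idx ℝ) = 1}
  one_mem' := ⟨one_mem _, by simp⟩
  mul_mem' := by
    rintro A B ⟨hA, hA'⟩ ⟨hB, hB'⟩
    refine ⟨mul_mem hA hB, ?_⟩
    calc _ = (B : Matrix G.Idx G.Idx ℝ)ᵀ *
          ((A : Matrix G.Idx G.Idx ℝ)ᵀ * (A : Matrix G.Idx G.Idx ℝ)) * B := by
          simp [Matrix.transpose_mul, Matrix.mul_assoc]
      _ = _ := by rw [hA', Matrix.mul_one, hB']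
  inv_mem' := by
    rintro A ⟨hA, hA'⟩
    refine ⟨inv_mem hA, ?_⟩
    have h1 : (A : Matrix G.Idx G.Idx ℝ) * ((A⁻¹ : GL G.Idx ℝ) : Matrix G.Idx G.Idx ℝ) = 1 := by
      rw [← Units.val_mul, mul_inv_cancel, Units.val_one]
    have h3 : (A : Matrix G.Idx G.Idx ℝ)ᵀ = ((A⁻¹ : GL G.Idx ℝ) : Matrix G.Idx G.Idx ℝ) := by
      calc _ = (A : Matrix G.Idx G.Idx ℝ)ᵀ *
            ((A : Matrix G.Idx G.Idx ℝ) * ((A⁻¹ : GL G.Idx ℝ) : Matrix G.Idx G.Idx ℝ)) := by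
            rw [h1, Matrix.mul_one]
        _ = _ := by rw [← Matrix.mul_assoc, hA', Matrix.one_mul]
    rw [← h3, Matrix.transpose_transpose, h3, h1]

theorem J_transpose_mul_J (G : ClassicalGroup) : G.Jᵀ * G.J = 1 := by
  cases G <;> simp [J, fromBlocks_transpose, fromBlocks_multiply]

theorem J_transpose (G : ClassicalGroup) : G.Jᵀ = G.eps • G.J := by
  cases G <;> simp [J, eps, fromBlocks_transpose, fromBlocks_neg]

theorem eps_mul_eps (G : ClassicalGroup) : G.eps * G.eps = 1 := by
  cases G <;> simp [eps]

/-- The complexified matrix of the bilinear form. -/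
def Jc (G : ClassicalGroup) : Matrix G.Idx G.Idx ℂ := G.J.map Complex.ofRealHom

/-- The involutive matrix `ξ` such that conjugation by `ξ` is the Cartan involution:
`ξ = diag(1,…,1,-1,…,-1)` for `O(p,q)`, and `ξ = [[0, i], [-i, 0]]` for `Sp(2n, ℝ)`. -/
def xi : (G : ClassicalGroup) → Matrix G.Idx G.Idx ℂ
  | O p q n h => (O p q n h).Jc
  | Sp n => Complex.I • (Sp n).Jc

theorem Jc_transpose_mul_Jc (G : ClassicalGroup) : G.Jcᵀ * G.Jc = 1 := by
  rw [Jc, ← Matrix.transpose_map, ← Matrix.map_mul, J_transpose_mul_J]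
  simp

theorem Jc_transpose (G : ClassicalGroup) : G.Jcᵀ = (G.eps : ℂ) • G.Jc := by
  rw [Jc, ← Matrix.transpose_map, J_transpose]
  ext; simp

theorem epsC_mul_epsC (G : ClassicalGroup) : (G.eps : ℂ) * G.eps = 1 := by
  exact_mod_cast G.eps_mul_eps

theorem Jc_mul_Jc (G : ClassicalGroup) : G.Jc * G.Jc = (G.eps : ℂ) • 1 := by
  have h := G.Jc_transpose_mul_Jc
  rw [Jc_transpose, Matrix.smul_mul] at h
  rw [← h, smul_smul, epsC_mul_epsC, one_smul]

/-- The scalar `tr ξ`: `p - q` for `O(p,q)` and `0` for `Sp(2n, ℝ)`. -/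
def traceXi : ClassicalGroup → ℝ
  | O p q _ _ => (p : ℝ) - q
  | Sp _ => 0

theorem trace_xi (G : ClassicalGroup) : G.xi.trace = G.traceXi := by
  cases G with
  | O p q n h =>
    simp [xi, Jc, J, traceXi, Matrix.trace, Fintype.sum_sum_type]; ring
  | Sp n => simp [xi, Jc, J, traceXi, Matrix.trace, Fintype.sum_sum_type]

theorem xi_mul_xi (G : ClassicalGroup) : G.xi * G.xi = 1 := by
  cases G with
  | O p q n h => rw [xi, Jc_mul_Jc]; simp [eps]
  | Sp n => rw [xi, Matrix.smul_mul, Matrix.mul_smul, Jc_mul_Jc]; simp [eps, smul_smul]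

/-- The complexified Lie algebra `𝔤 = {x : xᵀ J + J x = 0}` of `G`. -/
def lieAlg (G : ClassicalGroup) : LieSubalgebra ℂ (Matrix G.Idx G.Idx ℂ) :=
  skewAdjointMatricesLieSubalgebra G.Jc

theorem mem_lieAlg (G : ClassicalGroup) (x : Matrix G.Idx G.Idx ℂ) :
    x ∈ G.lieAlg ↔ xᵀ * G.Jc + G.Jc * x = 0 := by
  rw [lieAlg, mem_skewAdjointMatricesLieSubalgebra, mem_skewAdjointMatricesSubmodule]
  simp [Matrix.IsSkewAdjoint, Matrix.IsAdjointPair, eq_neg_iff_add_eq_zero]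

/-- The complex matrix of an element of `K`. -/
def cmat (G : ClassicalGroup) (κ : G.K) : Matrix G.Idx G.Idx ℂ :=
  ((κ : GL G.Idx ℝ) : Matrix G.Idx G.Idx ℝ).map Complex.ofRealHom

theorem cmat_mul (G : ClassicalGroup) (κ κ' : G.K) :
    G.cmat (κ * κ') = G.cmat κ * G.cmat κ' := by
  simp [cmat, Matrix.map_mul]

theorem cmat_one (G : ClassicalGroup) : G.cmat 1 = 1 := by
  simp [cmat]

theorem cmat_mul_inv (G : ClassicalGroup) (κ : G.K) : G.cmat κ * G.cmat κ⁻¹ = 1 := by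
  rw [← cmat_mul, mul_inv_cancel, cmat_one]

theorem cmat_inv_mul (G : ClassicalGroup) (κ : G.K) : G.cmat κ⁻¹ * G.cmat κ = 1 := by
  rw [← cmat_mul, inv_mul_cancel, cmat_one]

theorem cmat_transpose (G : ClassicalGroup) (κ : G.K) : (G.cmat κ)ᵀ = G.cmat κ⁻¹ := by
  have h : (G.cmat κ)ᵀ * G.cmat κ = 1 := by
    rw [cmat, ← Matrix.transpose_map, ← Matrix.map_mul, κ.2.2]; simp
  calc _ = (G.cmat κ)ᵀ * (G.cmat κ * G.cmat κ⁻¹) := by rw [cmat_mul_inv, Matrix.mul_one]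
    _ = _ := by rw [← Matrix.mul_assoc, h, Matrix.one_mul]

theorem cmat_comm_Jc (G : ClassicalGroup) (κ : G.K) : G.cmat κ * G.Jc = G.Jc * G.cmat κ := by
  have h : (G.cmat κ)ᵀ * G.Jc * G.cmat κ = G.Jc := by
    rw [cmat, Jc, ← Matrix.transpose_map, ← Matrix.map_mul, ← Matrix.map_mul]
    exact congrArg (fun M : Matrix G.Idx G.Idx ℝ => M.map Complex.ofRealHom) κ.2.1
  rw [cmat_transpose] at h
  calc _ = G.cmat κ * (G.cmat κ⁻¹ * G.Jc * G.cmat κ) := by rw [h]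
    _ = (G.cmat κ * G.cmat κ⁻¹) * G.Jc * G.cmat κ := by simp only [Matrix.mul_assoc]
    _ = _ := by rw [cmat_mul_inv, Matrix.one_mul]

theorem cmat_comm_xi (G : ClassicalGroup) (κ : G.K) : G.cmat κ * G.xi = G.xi * G.cmat κ := by
  cases G with
  | O p q n h => exact cmat_comm_Jc _ κ
  | Sp n => rw [xi, Matrix.mul_smul, Matrix.smul_mul, cmat_comm_Jc]

/-- The adjoint action of `K` on `𝔤`. -/
def Ad (G : ClassicalGroup) (κ : G.K) (x : G.lieAlg) : G.lieAlg :=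
  ⟨G.cmat κ * (x : Matrix G.Idx G.Idx ℂ) * G.cmat κ⁻¹, by
    have hx := (G.mem_lieAlg _).1 x.2
    rw [mem_lieAlg]
    have h1 : (G.cmat κ⁻¹)ᵀ = G.cmat κ := by rw [cmat_transpose, inv_inv]
    simp only [Matrix.transpose_mul, h1, cmat_transpose]
    calc _ = G.cmat κ * (x : Matrix G.Idx G.Idx ℂ)ᵀ * (G.cmat κ⁻¹ * G.Jc) +
          G.Jc * G.cmat κ * (x : Matrix G.Idx G.Idx ℂ) * G.cmat κ⁻¹ := by
          simp only [Matrix.mul_assoc]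
      _ = G.cmat κ * ((x : Matrix G.Idx G.Idx ℂ)ᵀ * G.Jc + G.Jc * (x : Matrix G.Idx G.Idx ℂ)) *
          G.cmat κ⁻¹ := by
          rw [cmat_comm_Jc G κ⁻¹, ← cmat_comm_Jc G κ]; simp only [Matrix.mul_assoc, Matrix.mul_add,
            Matrix.add_mul]
      _ = 0 := by rw [hx]; simp⟩

/-- The star operation `x ↦ -conj(x)` on `𝔤`, conjugation being taken with respect to the real form
`𝔤₀` of real matrices. -/
def lieStar (G : ClassicalGroup) (x : G.lieAlg) : G.lieAlg :=
  ⟨-(x : Matrix G.Idx G.Idx ℂ).map (starRingEnd ℂ), by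
    have hx := (G.mem_lieAlg _).1 x.2
    rw [mem_lieAlg]
    have hJ : G.Jc.map (starRingEnd ℂ) = G.Jc := by ext; simp [Jc]
    have h2 := congrArg (fun M : Matrix G.Idx G.Idx ℂ => M.map (starRingEnd ℂ)) hx
    simp only [Matrix.map_add _ (map_add (starRingEnd ℂ)), Matrix.map_mul, hJ,
      Matrix.map_zero _ (map_zero (starRingEnd ℂ)), Matrix.transpose_map] at h2
    rw [Matrix.transpose_neg, Matrix.neg_mul, Matrix.mul_neg, ← neg_add, h2, neg_zero]⟩

/-- A real matrix in `𝔨₀ = 𝔤₀ ∩ 𝔰𝔬(N)`, the Lie algebra of `K`. -/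
def IsCompactReal (G : ClassicalGroup) (Y : Matrix G.Idx G.Idx ℝ) : Prop :=
  Yᵀ * G.J + G.J * Y = 0 ∧ Yᵀ = -Y

/-- A real matrix in `𝔭₀`, the `-1` eigenspace of the Cartan involution `Y ↦ -Yᵀ` on `𝔤₀`. -/
def IsNoncompactReal (G : ClassicalGroup) (Y : Matrix G.Idx G.Idx ℝ) : Prop :=
  Yᵀ * G.J + G.J * Y = 0 ∧ Yᵀ = Y

/-- An element of `𝔨₀`, as an element of `𝔤`. -/
def ofCompact (G : ClassicalGroup) (Y : Matrix G.Idx G.Idx ℝ) (hY : G.IsCompactReal Y) :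
    G.lieAlg :=
  ⟨Y.map Complex.ofRealHom, by
    rw [mem_lieAlg, Jc, ← Matrix.transpose_map, ← Matrix.map_mul, ← Matrix.map_mul,
      ← Matrix.map_add _ (map_add Complex.ofRealHom), hY.1]
    ext; simp⟩

/-- `exp(tY) ∈ K` for `Y ∈ 𝔨₀`. -/
noncomputable def expK (G : ClassicalGroup) (Y : Matrix G.Idx G.Idx ℝ) (hY : G.IsCompactReal Y)
    (t : ℝ) : G.K :=
  ⟨⟨NormedSpace.exp (t • Y), NormedSpace.exp (-(t • Y)),
    by rw [← Matrix.exp_add_of_commute _ _ (Commute.neg_right (Commute.refl (t • Y)))]; simp,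
    by rw [← Matrix.exp_add_of_commute _ _ (Commute.neg_left (Commute.refl (t • Y)))]; simp⟩, by
    have hT : (NormedSpace.exp (t • Y))ᵀ = NormedSpace.exp (-(t • Y)) := by
      rw [← Matrix.exp_transpose, Matrix.transpose_smul, hY.2, smul_neg]
    have h1 : (NormedSpace.exp (t • Y))ᵀ * NormedSpace.exp (t • Y) = 1 := by
      rw [hT, ← Matrix.exp_add_of_commute _ _ (Commute.neg_left (Commute.refl (t • Y)))]; simp
    have hJ : G.J * Y * G.J⁻¹ = Y := by
      have hJJ : G.J * G.J⁻¹ = 1 := by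
        refine Matrix.mul_nonsing_inv _ ?_
        have := congrArg Matrix.det G.J_transpose_mul_J
        rw [Matrix.det_mul, Matrix.det_one] at this
        exact .of_mul_eq_one_right _ this
      have h := hY.1
      rw [hY.2, Matrix.neg_mul, neg_add_eq_zero] at h
      rw [← h, Matrix.mul_assoc, hJJ, Matrix.mul_one]
    have hJu : IsUnit G.J := .of_mul_eq_one_right _ G.J_transpose_mul_J
    have h2 : G.J * NormedSpace.exp (t • Y) = NormedSpace.exp (t • Y) * G.J := by
      have h3 := Matrix.exp_conj G.J (t • Y) hJu
      rw [Matrix.mul_smul, Matrix.smul_mul, hJ] at h3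
      conv_rhs => rw [h3]
      rw [Matrix.mul_assoc, Matrix.nonsing_inv_mul _ ((Matrix.isUnit_iff_isUnit_det _).1 hJu),
        Matrix.mul_one]
    refine ⟨?_, h1⟩
    change (NormedSpace.exp (t • Y))ᵀ * G.J * NormedSpace.exp (t • Y) = G.J
    rw [Matrix.mul_assoc, h2, ← Matrix.mul_assoc, h1, Matrix.one_mul]⟩

end ClassicalGroup

/-- A `(𝔤, K)`-module structure on the complex vector space `X`: compatible actions of `𝔤` and
of `K`, such that every vector is `K`-finite and the action of `𝔨₀` is the differential of that
of `K`.  The orbit map takes values in a finite-dimensional space, so its derivative is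
tested on linear functionals. -/
structure GKModule (G : ClassicalGroup) (X : Type*) [AddCommGroup X] [Module ℂ X] where
  lie : G.lieAlg →ₗ⁅ℂ⁆ Module.End ℂ X
  grp : G.K →* Module.End ℂ X
  grp_lie : ∀ (κ : G.K) (g : G.lieAlg) (x : X), grp κ (lie g x) = lie (G.Ad κ g) (grp κ x)
  finite : ∀ x : X, FiniteDimensional ℂ (Submodule.span ℂ (Set.range fun κ : G.K => grp κ x))
  deriv : ∀ (Y : Matrix G.Idx G.Idx ℝ) (hY : G.IsCompactReal Y) (x : X) (l : X →ₗ[ℂ] ℂ),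
    HasDerivAt (fun t : ℝ => l (grp (G.expK Y hY t) x)) (l (lie (G.ofCompact Y hY) x)) 0

theorem mul_neg_add_mul {R : Type*} [Ring R] (a b : R) : a * -b + a * b = 0 := by noncomm_ring

theorem neg_mul_add_mul {R : Type*} [Ring R] (a b : R) : -b * a + b * a = 0 := by noncomm_ring

section Casimir

variable {R : Type*} [Ring R] [Algebra ℂ R] {ι : Type*} [Fintype ι] [DecidableEq ι]

/-- The sum of `f(b) g(b*)` over the matrix units `b` and their duals `b*` for the trace form. -/
def casimirSum (f g : Matrix ι ι ℂ →ₗ[ℂ] R) : R :=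
  ∑ a, ∑ b, f (Matrix.single a b 1) * g (Matrix.single b a 1)

theorem casimirSum_mul_mul (f g : Matrix ι ι ℂ →ₗ[ℂ] R) (A B : Matrix ι ι ℂ) :
    ∑ a, ∑ b, f (A * Matrix.single a b 1 * B) * g (Matrix.single b a 1) =
      ∑ a, ∑ b, f (Matrix.single a b 1) * g (B * Matrix.single b a 1 * A) := by
  have key : ∀ (C D : Matrix ι ι ℂ) (a b : ι), C * Matrix.single a b 1 * D =
      ∑ c, ∑ d, (C c a * D b d) • Matrix.single c d (1 : ℂ) := by
    intro C D a b
    ext x y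
    simp [Matrix.sum_apply, Matrix.mul_apply, Matrix.single_apply, Finset.sum_ite_eq, ite_and]
  simp only [key, map_sum, map_smul, Finset.sum_mul, Finset.mul_sum, smul_mul_assoc,
    mul_smul_comm]
  calc _ = ∑ p : ι × ι × ι × ι, (A p.2.2.1 p.1 * B p.2.1 p.2.2.2) •
        (f (Matrix.single p.2.2.1 p.2.2.2 1) * g (Matrix.single p.2.1 p.1 1)) := by
        simp only [Fintype.sum_prod_type]
    _ = ∑ p : ι × ι × ι × ι, (B p.2.2.1 p.2.1 * A p.1 p.2.2.2) •
        (f (Matrix.single p.1 p.2.1 1) * g (Matrix.single p.2.2.1 p.2.2.2 1)) := by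
        refine Fintype.sum_equiv
          { toFun := fun p => (p.2.2.1, p.2.2.2, p.2.1, p.1)
            invFun := fun p => (p.2.2.2, p.2.2.1, p.1, p.2.1)
            left_inv := fun p => rfl
            right_inv := fun p => rfl } _ _ ?_
        rintro ⟨a, b, c, d⟩
        simp [mul_comm]
    _ = _ := by simp only [Fintype.sum_prod_type]

theorem casimirSum_mul_left (f g : Matrix ι ι ℂ →ₗ[ℂ] R) (A : Matrix ι ι ℂ) :
    ∑ a, ∑ b, f (A * Matrix.single a b 1) * g (Matrix.single b a 1) =
      ∑ a, ∑ b, f (Matrix.single a b 1) * g (Matrix.single b a 1 * A) := by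
  simpa using casimirSum_mul_mul f g A 1

theorem casimirSum_mul_right (f g : Matrix ι ι ℂ →ₗ[ℂ] R) (A : Matrix ι ι ℂ) :
    ∑ a, ∑ b, f (Matrix.single a b 1 * A) * g (Matrix.single b a 1) =
      ∑ a, ∑ b, f (Matrix.single a b 1) * g (A * Matrix.single b a 1) := by
  simpa using casimirSum_mul_mul f g 1 A

theorem casimirSum_transpose (f g : Matrix ι ι ℂ →ₗ[ℂ] R) :
    ∑ a, ∑ b, f (Matrix.single a b 1)ᵀ * g (Matrix.single b a 1) =
      ∑ a, ∑ b, f (Matrix.single a b 1) * g (Matrix.single b a 1)ᵀ := by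
  simp only [Matrix.transpose_single]
  rw [Finset.sum_comm]

theorem sum_single_diag : ∑ a : ι, Matrix.single a a (1 : ℂ) = 1 := by
  ext x y
  simp [Matrix.sum_apply, Matrix.single_apply, Matrix.one_apply, ite_and]

theorem casimirSum_comm (f g : Matrix ι ι ℂ →ₗ[ℂ] R) (h : ∀ A B, Commute (f A) (g B)) :
    casimirSum f g = casimirSum g f := by
  simp only [casimirSum]
  rw [Finset.sum_comm]
  exact Finset.sum_congr rfl fun a _ => Finset.sum_congr rfl fun b _ => (h _ _).eq

theorem casimirSum_add_left (f f' g : Matrix ι ι ℂ →ₗ[ℂ] R) :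
    casimirSum (f + f') g = casimirSum f g + casimirSum f' g := by
  simp [casimirSum, add_mul, Finset.sum_add_distrib]

theorem casimirSum_neg_left (f g : Matrix ι ι ℂ →ₗ[ℂ] R) :
    casimirSum (-f) g = -casimirSum f g := by
  simp only [casimirSum, LinearMap.neg_apply, neg_mul, Finset.sum_neg_distrib]

theorem smul_sub_smul_add_smul (a b c : ℂ) (x : R) : a • x - b • x + c • x = (a - b + c) • x := by
  module

theorem commute_casimirSum (f g : Matrix ι ι ℂ →ₗ[ℂ] R) (r : R)
    (hf : ∀ A, Commute r (f A)) (hg : ∀ A, Commute r (g A)) : Commute r (casimirSum f g) :=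
  Commute.sum_right _ _ _ fun _ _ => Commute.sum_right _ _ _ fun _ _ => (hf _).mul_right (hg _)

end Casimir

namespace ClassicalGroup

variable (G : ClassicalGroup)

/-- The defining module `V = ℂ^N`. -/
abbrev StdMod : Type := G.Idx → ℂ

/-- The vector space `X ⊗ V^{⊗k}`. -/
abbrev TensorSpace (k : ℕ) (X : Type*) [AddCommGroup X] [Module ℂ X] : Type _ :=
  X ⊗[ℂ] (⨂[ℂ] _ : Fin k, G.StdMod)

variable {G} {k : ℕ} {X : Type*} [AddCommGroup X] [Module ℂ X]

theorem tensorSpace_ext {Z : Type*} [AddCommGroup Z] [Module ℂ Z]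
    {f g : G.TensorSpace k X →ₗ[ℂ] Z}
    (h : ∀ x v, f (x ⊗ₜ PiTensorProduct.tprod ℂ v) = g (x ⊗ₜ PiTensorProduct.tprod ℂ v)) :
    f = g := by
  refine TensorProduct.ext (LinearMap.ext fun x => PiTensorProduct.ext (MultilinearMap.ext ?_))
  intro v
  exact h x v

variable (G k X) in
/-- `site i A` is the matrix `A` acting on the `i`-th copy of `V` in `X ⊗ V^{⊗k}`. -/
noncomputable def siteFun (i : Fin k) (A : Matrix G.Idx G.Idx ℂ) :
    Module.End ℂ (G.TensorSpace k X) :=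
  LinearMap.lTensor X
    (PiTensorProduct.map (Function.update (fun _ => LinearMap.id) i (Matrix.toLin' A)))

theorem siteFun_tmul (i : Fin k) (A : Matrix G.Idx G.Idx ℂ) (x : X) (v : Fin k → G.StdMod) :
    siteFun G k X i A (x ⊗ₜ PiTensorProduct.tprod ℂ v) =
      x ⊗ₜ PiTensorProduct.tprod ℂ (Function.update v i (A *ᵥ v i)) := by
  rw [siteFun, LinearMap.lTensor_tmul, PiTensorProduct.map_tprod]
  congr 2
  ext1 j
  by_cases h : j = i
  · subst h; simp
  · simp [h]

variable (G k X) in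
/-- The action of matrices on the `i`-th copy of `V` in `X ⊗ V^{⊗k}`. -/
noncomputable def site (i : Fin k) :
    Matrix G.Idx G.Idx ℂ →ₐ[ℂ] Module.End ℂ (G.TensorSpace k X) :=
  AlgHom.ofLinearMap
    { toFun := siteFun G k X i
      map_add' := by
        intro A B
        refine tensorSpace_ext fun x v => ?_
        rw [LinearMap.add_apply, siteFun_tmul, siteFun_tmul, siteFun_tmul, Matrix.add_mulVec,
          MultilinearMap.map_update_add, TensorProduct.tmul_add]
      map_smul' := by
        intro c A
        refine tensorSpace_ext fun x v => ?_
        rw [RingHom.id_apply, LinearMap.smul_apply, siteFun_tmul, siteFun_tmul,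
          Matrix.smul_mulVec, MultilinearMap.map_update_smul, TensorProduct.tmul_smul] }
    (by
      refine tensorSpace_ext fun x v => ?_
      change siteFun G k X i 1 _ = _
      rw [siteFun_tmul]; simp)
    (by
      intro A B
      refine tensorSpace_ext fun x v => ?_
      rw [Module.End.mul_apply]
      change siteFun G k X i (A * B) (x ⊗ₜ PiTensorProduct.tprod ℂ v) =
        siteFun G k X i A (siteFun G k X i B (x ⊗ₜ PiTensorProduct.tprod ℂ v))
      rw [siteFun_tmul, siteFun_tmul, siteFun_tmul]; simp)

theorem site_tmul (i : Fin k) (A : Matrix G.Idx G.Idx ℂ) (x : X) (v : Fin k → G.StdMod) :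
    site G k X i A (x ⊗ₜ PiTensorProduct.tprod ℂ v) =
      x ⊗ₜ PiTensorProduct.tprod ℂ (Function.update v i (A *ᵥ v i)) :=
  siteFun_tmul i A x v

theorem site_commute {i j : Fin k} (h : i ≠ j) (A B : Matrix G.Idx G.Idx ℂ) :
    Commute (site G k X i A) (site G k X j B) := by
  refine tensorSpace_ext fun x v => ?_
  rw [Module.End.mul_apply, Module.End.mul_apply, site_tmul, site_tmul, site_tmul, site_tmul,
    Function.update_of_ne h, Function.update_of_ne h.symm, Function.update_comm h]

variable (G k X) in
/-- The action of the symmetric group on `X ⊗ V^{⊗k}` by permuting the copies of `V`. -/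
noncomputable def perm (σ : Equiv.Perm (Fin k)) : Module.End ℂ (G.TensorSpace k X) :=
  LinearMap.lTensor X (PiTensorProduct.reindex ℂ (fun _ : Fin k => G.StdMod) σ).toLinearMap

theorem perm_tmul (σ : Equiv.Perm (Fin k)) (x : X) (v : Fin k → G.StdMod) :
    perm G k X σ (x ⊗ₜ PiTensorProduct.tprod ℂ v) =
      x ⊗ₜ PiTensorProduct.tprod ℂ (fun i => v (σ.symm i)) := by
  rw [perm, LinearMap.lTensor_tmul]
  congr 1
  exact PiTensorProduct.reindex_tprod σ v

theorem perm_mul (σ τ : Equiv.Perm (Fin k)) : perm G k X (σ * τ) = perm G k X σ * perm G k X τ := by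
  refine tensorSpace_ext fun x v => ?_
  rw [Module.End.mul_apply, perm_tmul, perm_tmul, perm_tmul]
  rfl

theorem perm_one : perm G k X 1 = 1 := by
  refine tensorSpace_ext fun x v => ?_
  rw [perm_tmul]
  rfl

theorem perm_mul_site (σ : Equiv.Perm (Fin k)) (i : Fin k) (A : Matrix G.Idx G.Idx ℂ) :
    perm G k X σ * site G k X i A = site G k X (σ i) A * perm G k X σ := by
  refine tensorSpace_ext fun x v => ?_
  rw [Module.End.mul_apply, Module.End.mul_apply, perm_tmul, site_tmul, site_tmul, perm_tmul]
  congr 2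
  ext1 j
  by_cases h : j = σ i
  · subst h; simp
  · have : σ.symm j ≠ i := fun h' => h (by rw [← h']; simp)
    simp [h, this]

/-- The transposition of two factors in terms of matrix units. -/
theorem perm_swap {i j : Fin k} (h : i ≠ j) : perm G k X (Equiv.swap i j) =
    casimirSum (site G k X i).toLinearMap (site G k X j).toLinearMap := by
  refine tensorSpace_ext fun x v => ?_
  simp only [casimirSum, LinearMap.sum_apply, AlgHom.toLinearMap_apply, Module.End.mul_apply]
  have h1 : ∀ (a b : G.Idx) (w : G.StdMod),
      Matrix.single a b (1 : ℂ) *ᵥ w = w b • Pi.single a (1 : ℂ) := by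
    intro a b w
    ext c
    simp [Matrix.mulVec, dotProduct, Matrix.single_apply, Pi.single_apply, ite_and, eq_comm]
  have h2 : ∀ w : G.StdMod, w = ∑ a, w a • Pi.single a (1 : ℂ) := by
    intro w
    ext c
    simp [Finset.sum_apply, Pi.single_apply]
  simp only [site_tmul, h1, MultilinearMap.map_update_smul]
  have h3 : ∀ (w w' : G.StdMod), PiTensorProduct.tprod ℂ (Function.update (Function.update v j w) i w')
      = ∑ a, ∑ b, w' a • w b • PiTensorProduct.tprod ℂ (Function.update (Function.update v j
        (Pi.single b (1 : ℂ))) i (Pi.single a (1 : ℂ)) : Fin k → G.StdMod) := by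
    intro w w'
    conv_lhs => rw [h2 w', MultilinearMap.map_update_sum]
    refine Finset.sum_congr rfl fun a _ => ?_
    rw [MultilinearMap.map_update_smul, Function.update_comm h.symm]
    conv_lhs => rw [h2 w, MultilinearMap.map_update_sum, Finset.smul_sum]
    refine Finset.sum_congr rfl fun b _ => ?_
    rw [MultilinearMap.map_update_smul, Function.update_comm h.symm]
  rw [perm_tmul]
  have h4 : (fun l => v ((Equiv.swap i j).symm l)) =
      Function.update (Function.update v j (v i)) i (v j) := by
    ext1 l
    rw [Equiv.symm_swap]
    by_cases hi : l = i
    · subst hi; simp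
    by_cases hj : l = j
    · subst hj; simp [h.symm]
    · simp [hi, hj, Equiv.swap_apply_of_ne_of_ne]
  rw [h4, h3, TensorProduct.tmul_sum]
  refine Finset.sum_congr rfl fun a _ => ?_
  rw [TensorProduct.tmul_sum]
  refine Finset.sum_congr rfl fun b _ => ?_
  simp only [TensorProduct.tmul_smul]
  rw [map_smul, site_tmul, h1, Function.update_of_ne h, MultilinearMap.map_update_smul,
    TensorProduct.tmul_smul]

end ClassicalGroup

namespace ClassicalGroup

variable (G : ClassicalGroup)

/-- The adjoint `A ↦ J⁻¹ Aᵀ J` with respect to the bilinear form (recall `J⁻¹ = Jᵀ`). -/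
def tau : Matrix G.Idx G.Idx ℂ →ₗ[ℂ] Matrix G.Idx G.Idx ℂ where
  toFun A := G.Jcᵀ * Aᵀ * G.Jc
  map_add' := by intro A B; simp [Matrix.mul_add, Matrix.add_mul]
  map_smul' := by intro c A; simp

theorem tau_apply (A : Matrix G.Idx G.Idx ℂ) : G.tau A = G.Jcᵀ * Aᵀ * G.Jc := rfl

theorem Jc_mul_Jc_transpose : G.Jc * G.Jcᵀ = 1 := by
  rw [mul_eq_one_comm, Jc_transpose_mul_Jc]

theorem tau_mul (A B : Matrix G.Idx G.Idx ℂ) : G.tau (A * B) = G.tau B * G.tau A := by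
  simp only [tau_apply, Matrix.transpose_mul]
  calc _ = G.Jcᵀ * Bᵀ * 1 * Aᵀ * G.Jc := by simp only [Matrix.mul_assoc, Matrix.one_mul]
    _ = _ := by rw [← Jc_mul_Jc_transpose]; simp only [Matrix.mul_assoc]

theorem tau_one : G.tau 1 = 1 := by
  rw [tau_apply, Matrix.transpose_one, Matrix.mul_one, Jc_transpose_mul_Jc]

theorem Jc_eq : G.Jc = (G.eps : ℂ) • G.Jcᵀ := by
  rw [Jc_transpose, smul_smul, epsC_mul_epsC, one_smul]

theorem Jc_mul_mul_transpose (A : Matrix G.Idx G.Idx ℂ) : G.Jc * A * G.Jcᵀ = G.Jcᵀ * A * G.Jc := by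
  rw [Jc_transpose]; simp

theorem tau_tau (A : Matrix G.Idx G.Idx ℂ) : G.tau (G.tau A) = A := by
  rw [tau_apply, tau_apply]
  simp only [Matrix.transpose_mul, Matrix.transpose_transpose]
  calc _ = (G.Jcᵀ * G.Jcᵀ) * A * (G.Jc * G.Jc) := by simp only [Matrix.mul_assoc]
    _ = _ := by
      rw [← Matrix.transpose_mul, Jc_mul_Jc]
      simp [smul_smul, eps_mul_eps]

theorem mem_lieAlg_iff_tau (x : Matrix G.Idx G.Idx ℂ) : x ∈ G.lieAlg ↔ G.tau x = -x := by
  rw [mem_lieAlg, tau_apply]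
  constructor
  · intro h
    rw [Matrix.mul_assoc, eq_neg_of_add_eq_zero_left h, Matrix.mul_neg, ← Matrix.mul_assoc,
      Jc_transpose_mul_Jc, Matrix.one_mul]
  · intro h
    have h2 := congrArg (fun y => G.Jc * y) h
    simp only [← Matrix.mul_assoc, Jc_mul_Jc_transpose, Matrix.one_mul, Matrix.mul_neg] at h2
    rw [h2, neg_add_cancel]

theorem tau_Jc : G.tau G.Jc = (G.eps : ℂ) • G.Jc := by
  rw [tau_apply, Matrix.mul_assoc, Jc_transpose_mul_Jc, Matrix.mul_one, Jc_transpose]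

theorem tau_xi : G.tau G.xi = (G.eps : ℂ) • G.xi := by
  cases G with
  | O p q n h => exact tau_Jc _
  | Sp n => rw [xi, map_smul, tau_Jc, smul_comm]

/-- The map `A ↦ A - J⁻¹ Aᵀ J` from matrices to `𝔤` (twice the projection onto `𝔤` that is
orthogonal for the trace form). -/
def skew : Matrix G.Idx G.Idx ℂ →ₗ[ℂ] G.lieAlg where
  toFun A := ⟨A - G.tau A, by rw [mem_lieAlg_iff_tau, map_sub, tau_tau]; abel⟩
  map_add' := by intro A B; ext1; simp; abel
  map_smul' := by intro c A; ext1; simp [smul_sub]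

theorem skew_coe (A : Matrix G.Idx G.Idx ℂ) :
    (G.skew A : Matrix G.Idx G.Idx ℂ) = A - G.tau A := rfl

theorem skew_tau (A : Matrix G.Idx G.Idx ℂ) : G.skew (G.tau A) = -G.skew A := by
  ext1; simp [skew_coe, tau_tau]

theorem lie_coe (x y : G.lieAlg) : ((⁅x, y⁆ : G.lieAlg) : Matrix G.Idx G.Idx ℂ) =
    (x : Matrix G.Idx G.Idx ℂ) * (y : Matrix G.Idx G.Idx ℂ) -
      (y : Matrix G.Idx G.Idx ℂ) * (x : Matrix G.Idx G.Idx ℂ) := rfl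

theorem lie_skew (x : G.lieAlg) (A : Matrix G.Idx G.Idx ℂ) :
    ⁅x, G.skew A⁆ = G.skew ((x : Matrix G.Idx G.Idx ℂ) * A - A * (x : Matrix G.Idx G.Idx ℂ)) := by
  have hx := (G.mem_lieAlg_iff_tau _).1 x.2
  ext1
  rw [lie_coe, skew_coe, skew_coe, map_sub, tau_mul, tau_mul, hx]
  noncomm_ring

theorem Ad_skew (κ : G.K) (A : Matrix G.Idx G.Idx ℂ) :
    G.Ad κ (G.skew A) = G.skew (G.cmat κ * A * G.cmat κ⁻¹) := by
  have h : ∀ κ : G.K, G.tau (G.cmat κ) = G.cmat κ⁻¹ := by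
    intro κ
    rw [tau_apply, cmat_transpose, Matrix.mul_assoc, cmat_comm_Jc, ← Matrix.mul_assoc,
      Jc_transpose_mul_Jc, Matrix.one_mul]
  ext1
  rw [skew_coe, tau_mul, tau_mul, h, h, inv_inv]
  change G.cmat κ * (A - G.tau A) * G.cmat κ⁻¹ = _
  noncomm_ring

theorem tau_cmat (κ : G.K) : G.tau (G.cmat κ) = G.cmat κ⁻¹ := by
  rw [tau_apply, cmat_transpose, Matrix.mul_assoc, cmat_comm_Jc, ← Matrix.mul_assoc,
    Jc_transpose_mul_Jc, Matrix.one_mul]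

variable {G}

theorem casimirSum_tau {R : Type*} [Ring R] [Algebra ℂ R]
    (f g : Matrix G.Idx G.Idx ℂ →ₗ[ℂ] R) :
    casimirSum (f ∘ₗ G.tau) g = casimirSum f (g ∘ₗ G.tau) := by
  have h1 := casimirSum_transpose
    (f ∘ₗ LinearMap.mulLeft ℂ G.Jcᵀ ∘ₗ LinearMap.mulRight ℂ G.Jc) g
  have h2 := casimirSum_mul_mul f
    (g ∘ₗ { toFun := Matrix.transpose, map_add' := Matrix.transpose_add,
            map_smul' := Matrix.transpose_smul }) G.Jcᵀ G.Jc
  simp only [LinearMap.comp_apply, LinearMap.mulLeft_apply, LinearMap.mulRight_apply,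
    LinearMap.coe_mk, AddHom.coe_mk, ← Matrix.mul_assoc] at h1 h2
  simp only [casimirSum, LinearMap.comp_apply, tau_apply]
  rw [h1, h2]
  refine Finset.sum_congr rfl fun a _ => Finset.sum_congr rfl fun b _ => ?_
  rw [Matrix.transpose_mul, Matrix.transpose_mul, Matrix.transpose_transpose, ← Matrix.mul_assoc,
    Jc_mul_mul_transpose]

variable {k : ℕ} {X : Type*} [AddCommGroup X] [Module ℂ X]

variable (G k X) in
/-- The contraction operator on the `i`-th and `j`-th copies of `V`.  On `V ⊗ V` it is
`v ⊗ w ↦ ε B(v, w) ∑ J_{ab} e_a ⊗ e_b` where `B(v, w) = vᵀ J w`, that is, `ε N` times the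
projection onto the trivial submodule. -/
noncomputable def contraction (i j : Fin k) : Module.End ℂ (G.TensorSpace k X) :=
  (G.eps : ℂ) • casimirSum (site G k X i).toLinearMap ((site G k X j).toLinearMap ∘ₗ G.tau)

theorem contraction_mul_site {i j : Fin k} (h : i ≠ j) (A : Matrix G.Idx G.Idx ℂ) :
    contraction G k X i j * site G k X i A = contraction G k X i j * site G k X j (G.tau A) := by
  have h1 := casimirSum_mul_right (site G k X i).toLinearMap
    ((site G k X j).toLinearMap ∘ₗ G.tau) A
  simp only [AlgHom.toLinearMap_apply, LinearMap.comp_apply, tau_mul, map_mul] at h1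
  simp only [contraction, casimirSum, smul_mul_assoc, Finset.sum_mul, AlgHom.toLinearMap_apply,
    LinearMap.comp_apply]
  congr 1
  simp only [← mul_assoc] at h1
  rw [← h1]
  refine Finset.sum_congr rfl fun a _ => Finset.sum_congr rfl fun b _ => ?_
  rw [mul_assoc, mul_assoc, (site_commute h _ _).eq]

theorem site_mul_contraction {i j : Fin k} (h : i ≠ j) (A : Matrix G.Idx G.Idx ℂ) :
    site G k X i A * contraction G k X i j = site G k X j (G.tau A) * contraction G k X i j := by
  have h1 := casimirSum_mul_left (site G k X i).toLinearMap
    ((site G k X j).toLinearMap ∘ₗ G.tau) A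
  simp only [AlgHom.toLinearMap_apply, LinearMap.comp_apply, tau_mul, map_mul] at h1
  simp only [contraction, casimirSum, mul_smul_comm, Finset.mul_sum, AlgHom.toLinearMap_apply,
    LinearMap.comp_apply]
  congr 1
  simp only [mul_assoc] at h1
  rw [h1]
  refine Finset.sum_congr rfl fun a _ => Finset.sum_congr rfl fun b _ => ?_
  rw [← mul_assoc, ← mul_assoc, (site_commute h _ _).eq]

theorem contraction_comm {i j : Fin k} (h : i ≠ j) :
    contraction G k X i j = contraction G k X j i := by
  rw [contraction, contraction, ← casimirSum_tau, casimirSum_comm]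
  intro A B
  exact site_commute h _ _

theorem contraction_site_contraction {i j : Fin k} (h : i ≠ j) (A : Matrix G.Idx G.Idx ℂ) :
    contraction G k X i j * site G k X i A * contraction G k X i j =
      ((G.eps : ℂ) * A.trace) • contraction G k X i j := by
  have key : contraction G k X i j * site G k X i A *
      casimirSum (site G k X i).toLinearMap ((site G k X j).toLinearMap ∘ₗ G.tau) =
      A.trace • contraction G k X i j := by
    simp only [casimirSum, Finset.mul_sum, AlgHom.toLinearMap_apply, LinearMap.comp_apply]
    have h1 : ∀ a b : G.Idx, contraction G k X i j * site G k X i A *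
        (site G k X i (Matrix.single a b 1) * site G k X j (G.tau (Matrix.single b a 1))) =
        A a a • (contraction G k X i j * site G k X j (G.tau (Matrix.single b b 1))) := by
      intro a b
      rw [mul_assoc, ← mul_assoc (site G k X i A), ← map_mul, ← mul_assoc,
        contraction_mul_site h, mul_assoc, ← map_mul, ← tau_mul, ← mul_smul_comm, ← map_smul,
        ← map_smul]
      congr 3
      ext x y
      simp [Matrix.mul_apply, Matrix.single_apply, ite_and]
      split_ifs <;> rfl
    simp only [h1]
    rw [Finset.sum_comm]
    simp only [← Finset.sum_smul, ← Finset.smul_sum, ← Finset.mul_sum]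
    rw [← map_sum, ← map_sum, sum_single_diag, tau_one, map_one, mul_one]
    rfl
  conv_lhs => rw [contraction.eq_1 G k X i j, mul_smul_comm]
  rw [← contraction.eq_1 G k X i j, key, smul_smul]

theorem commute_contraction {i j : Fin k} (T : Module.End ℂ (G.TensorSpace k X))
    (hi : ∀ A, Commute T (site G k X i A)) (hj : ∀ A, Commute T (site G k X j A)) :
    Commute T (contraction G k X i j) :=
  (commute_casimirSum _ _ T hi fun _ => hj _).smul_right _

theorem contraction_sq {i j : Fin k} (h : i ≠ j) :
    contraction G k X i j * contraction G k X i j =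
      ((G.eps * G.dim : ℝ) : ℂ) • contraction G k X i j := by
  have := contraction_site_contraction (G := G) (X := X) h 1
  rw [map_one, mul_one, Matrix.trace_one] at this
  rw [this]
  simp [dim]

theorem perm_swap_mul_contraction {i j : Fin k} (h : i ≠ j) :
    perm G k X (Equiv.swap i j) * contraction G k X i j =
      (G.eps : ℂ) • contraction G k X i j := by
  rw [perm_swap h]
  simp only [casimirSum, Finset.sum_mul, AlgHom.toLinearMap_apply]
  have h1 : ∀ a b : G.Idx, site G k X i (Matrix.single a b 1) *
      site G k X j (Matrix.single b a 1) * contraction G k X i j =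
      site G k X i (Matrix.single a b 1 * G.tau (Matrix.single b a 1)) *
        contraction G k X i j := by
    intro a b
    rw [map_mul, mul_assoc, mul_assoc, site_mul_contraction h (G.tau _), tau_tau]
  simp only [h1, ← Finset.sum_mul, ← map_sum]
  have h2 : ∑ a : G.Idx, ∑ b : G.Idx, Matrix.single a b 1 * G.tau (Matrix.single b a (1 : ℂ)) =
      (G.eps : ℂ) • (1 : Matrix G.Idx G.Idx ℂ) := by
    have h3 : ∀ a b : G.Idx, Matrix.single a b 1 * G.tau (Matrix.single b a (1 : ℂ)) =
        (G.Jcᵀ b a • Matrix.single a b 1) * G.Jc := by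
      intro a b
      rw [tau_apply, Matrix.transpose_single, ← Matrix.mul_assoc, ← Matrix.mul_assoc]
      congr 1
      ext x y
      simp [Matrix.mul_apply, Matrix.single_apply, ite_and]
      split_ifs <;> rfl
    simp only [h3, ← Finset.sum_mul]
    have h4 : ∑ a : G.Idx, ∑ b : G.Idx, G.Jcᵀ b a • Matrix.single a b (1 : ℂ) = G.Jc := by
      conv_rhs => rw [Matrix.matrix_eq_sum_single G.Jc]
      simp
    rw [h4, Jc_mul_Jc]
  rw [h2, map_smul, map_one, smul_mul_assoc, one_mul]

theorem perm_mul_contraction (σ : Equiv.Perm (Fin k)) (i j : Fin k) :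
    perm G k X σ * contraction G k X i j = contraction G k X (σ i) (σ j) * perm G k X σ := by
  simp only [contraction, casimirSum, mul_smul_comm, smul_mul_assoc, Finset.mul_sum,
    Finset.sum_mul, AlgHom.toLinearMap_apply, LinearMap.comp_apply]
  congr 1
  refine Finset.sum_congr rfl fun a _ => Finset.sum_congr rfl fun b _ => ?_
  rw [← mul_assoc, perm_mul_site, mul_assoc, perm_mul_site, mul_assoc]

theorem contraction_mul_perm_swap {i j : Fin k} (h : i ≠ j) :
    contraction G k X i j * perm G k X (Equiv.swap i j) =
      (G.eps : ℂ) • contraction G k X i j := by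
  have h1 := perm_mul_contraction (G := G) (X := X) (Equiv.swap i j) i j
  rw [Equiv.swap_apply_left, Equiv.swap_apply_right, ← contraction_comm h] at h1
  rw [← h1, perm_swap_mul_contraction h]

theorem contraction_perm_contraction {i j l : Fin k} (hij : i ≠ j) (hjl : j ≠ l) (hil : i ≠ l) :
    contraction G k X i j * perm G k X (Equiv.swap j l) * contraction G k X i j =
      (G.eps : ℂ) • contraction G k X i j := by
  rw [perm_swap hjl]
  simp only [casimirSum, Finset.mul_sum, Finset.sum_mul, AlgHom.toLinearMap_apply]
  have h1 : ∀ a b : G.Idx, contraction G k X i j * (site G k X j (Matrix.single a b 1) *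
      site G k X l (Matrix.single b a 1)) * contraction G k X i j =
      ((G.eps : ℂ) * (Matrix.single a b (1 : ℂ)).trace) •
        (contraction G k X i j * site G k X l (Matrix.single b a 1)) := by
    intro a b
    have hc : Commute (site G k X l (Matrix.single b a 1)) (contraction G k X i j) :=
      commute_contraction _ (fun _ => site_commute hil.symm _ _)
        (fun _ => site_commute hjl.symm _ _)
    rw [mul_assoc, mul_assoc (site G k X j _), hc.eq, ← mul_assoc, ← mul_assoc,
      contraction_comm hij, contraction_site_contraction hij.symm, smul_mul_assoc]
  simp only [h1]
  have h2 : ∀ a : G.Idx, ∑ b : G.Idx, ((G.eps : ℂ) * (Matrix.single a b (1 : ℂ)).trace) •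
        (contraction G k X i j * site G k X l (Matrix.single b a 1)) =
      (G.eps : ℂ) • (contraction G k X i j * site G k X l (Matrix.single a a 1)) := by
    intro a
    rw [Finset.sum_eq_single a]
    · simp
    · intro b _ hb
      simp [Matrix.trace_single_eq_of_ne _ _ _ hb.symm]
    · simp
  simp only [h2]
  rw [← Finset.smul_sum, ← Finset.mul_sum, ← map_sum, sum_single_diag, map_one, mul_one]

end ClassicalGroup

namespace GKModule
open ClassicalGroup

variable {G : ClassicalGroup} {X : Type*} [AddCommGroup X] [Module ℂ X] (M : GKModule G X) (k : ℕ)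

/-- The action of `x ∈ 𝔤` on the `s`-th factor of `X ⊗ V^{⊗k}`; the factor `X` is labelled by
`none` and the copies of `V` by `some i`. -/
noncomputable def factor : Option (Fin k) → G.lieAlg →ₗ[ℂ] Module.End ℂ (G.TensorSpace k X)
  | none =>
    { toFun := fun x => LinearMap.rTensor _ (M.lie x)
      map_add' := fun x y => by rw [map_add, LinearMap.rTensor_add]
      map_smul' := fun c x => by rw [map_smul, LinearMap.rTensor_smul, RingHom.id_apply] }
  | some i => (site G k X i).toLinearMap ∘ₗ G.lieAlg.toSubmodule.subtype

/-- `Ω_{s,j} = ∑ (b)_s (b*)_j`, summed over a basis `b` of `𝔤` and its dual basis `b*` for the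
invariant form `(x, y) ↦ tr(xy) / 2` on `𝔤`. -/
noncomputable def omega (s : Option (Fin k)) (j : Fin k) : Module.End ℂ (G.TensorSpace k X) :=
  casimirSum (M.factor k s ∘ₗ G.skew) (site G k X j).toLinearMap

/-- The factors to the left of the `j`-th copy of `V`. -/
def leftOf (j : Fin k) : Finset (Option (Fin k)) := Finset.insertNone (Finset.Iio j)

/-- The operator by which `z_j` acts: `ε (∑_{s < j} Ω_{s,j} + (N - ε)/2)`.  The constant
is half the eigenvalue of the Casimir element on `V`. -/
noncomputable def zOp (j : Fin k) : Module.End ℂ (G.TensorSpace k X) :=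
  (G.eps : ℂ) • (∑ s ∈ leftOf k j, M.omega k s j + (((G.dim - G.eps) / 2 : ℝ) : ℂ) • 1)

variable {k}

theorem factor_none_tmul (x : G.lieAlg) (y : X) (v : Fin k → G.StdMod) :
    M.factor k none x (y ⊗ₜ PiTensorProduct.tprod ℂ v) =
      M.lie x y ⊗ₜ PiTensorProduct.tprod ℂ v := rfl

theorem factor_some (i : Fin k) (x : G.lieAlg) :
    M.factor k (some i) x = site G k X i (x : Matrix G.Idx G.Idx ℂ) := rfl

theorem factor_commute_site {s : Option (Fin k)} {j : Fin k} (h : s ≠ some j) (x : G.lieAlg)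
    (A : Matrix G.Idx G.Idx ℂ) : Commute (M.factor k s x) (site G k X j A) := by
  cases s with
  | none =>
    refine tensorSpace_ext fun y v => ?_
    rw [Module.End.mul_apply, Module.End.mul_apply, site_tmul, factor_none_tmul, factor_none_tmul,
      site_tmul]
  | some i => exact site_commute (fun h' => h (by rw [h'])) _ _

theorem factor_commute_factor {s s' : Option (Fin k)} (h : s ≠ s') (x y : G.lieAlg) :
    Commute (M.factor k s x) (M.factor k s' y) := by
  cases s' with
  | none =>
    cases s with
    | none => exact absurd rfl h
    | some i => exact (M.factor_commute_site (Option.some_ne_none i).symm _ _).symm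
  | some j => exact M.factor_commute_site h _ _

theorem factor_lie (s : Option (Fin k)) (x y : G.lieAlg) :
    M.factor k s ⁅x, y⁆ =
      M.factor k s x * M.factor k s y - M.factor k s y * M.factor k s x := by
  cases s with
  | none =>
    refine tensorSpace_ext fun z v => ?_
    rw [LinearMap.sub_apply, Module.End.mul_apply, Module.End.mul_apply]
    simp only [factor_none_tmul]
    rw [LieHom.map_lie, ← TensorProduct.sub_tmul]
    rfl
  | some i => rw [factor_some, lie_coe, map_sub, map_mul, map_mul]; rfl

theorem commute_omega {s : Option (Fin k)} {j : Fin k} (T : Module.End ℂ (G.TensorSpace k X))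
    (hs : ∀ x, Commute T (M.factor k s x)) (hj : ∀ A, Commute T (site G k X j A)) :
    Commute T (M.omega k s j) :=
  commute_casimirSum _ _ T (fun _ => hs _) hj

theorem omega_some {i j : Fin k} (h : i ≠ j) : M.omega k (some i) j =
    perm G k X (Equiv.swap i j) - (G.eps : ℂ) • contraction G k X i j := by
  rw [contraction, smul_smul, epsC_mul_epsC, one_smul, ← casimirSum_tau, perm_swap h, omega]
  simp only [casimirSum, ← Finset.sum_sub_distrib, ← sub_mul, LinearMap.comp_apply]
  refine Finset.sum_congr rfl fun a _ => Finset.sum_congr rfl fun b _ => ?_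
  rw [factor_some, skew_coe, map_sub]
  rfl

theorem perm_mul_factor (σ : Equiv.Perm (Fin k)) (s : Option (Fin k)) (x : G.lieAlg) :
    perm G k X σ * M.factor k s x = M.factor k (s.map σ) x * perm G k X σ := by
  cases s with
  | none =>
    refine tensorSpace_ext fun z v => ?_
    rw [Module.End.mul_apply, Module.End.mul_apply, factor_none_tmul, perm_tmul, perm_tmul]
    rfl
  | some i => exact perm_mul_site _ _ _

theorem perm_mul_omega (σ : Equiv.Perm (Fin k)) (s : Option (Fin k)) (j : Fin k) :
    perm G k X σ * M.omega k s j = M.omega k (s.map σ) (σ j) * perm G k X σ := by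
  simp only [omega, casimirSum, Finset.mul_sum, Finset.sum_mul, AlgHom.toLinearMap_apply,
    LinearMap.comp_apply]
  refine Finset.sum_congr rfl fun a _ => Finset.sum_congr rfl fun b _ => ?_
  rw [← mul_assoc, perm_mul_factor, mul_assoc, perm_mul_site, mul_assoc]

theorem casimirSum_factor_tau (s : Option (Fin k)) (f : Matrix G.Idx G.Idx ℂ →ₗ[ℂ]
    Module.End ℂ (G.TensorSpace k X)) :
    casimirSum (M.factor k s ∘ₗ G.skew) (f ∘ₗ G.tau) =
      -casimirSum (M.factor k s ∘ₗ G.skew) f := by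
  rw [← casimirSum_tau, ← casimirSum_neg_left]
  congr 1
  ext1 A
  simp only [LinearMap.comp_apply, LinearMap.neg_apply, skew_tau, map_neg]

theorem contraction_mul_omega {s : Option (Fin k)} {i j : Fin k} (h : i ≠ j) (hi : s ≠ some i)
    (hj : s ≠ some j) :
    contraction G k X i j * (M.omega k s i + M.omega k s j) = 0 := by
  have h1 : contraction G k X i j * M.omega k s i = contraction G k X i j *
      casimirSum (M.factor k s ∘ₗ G.skew) ((site G k X j).toLinearMap ∘ₗ G.tau) := by
    simp only [omega, casimirSum, Finset.mul_sum, AlgHom.toLinearMap_apply, LinearMap.comp_apply]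
    refine Finset.sum_congr rfl fun a _ => Finset.sum_congr rfl fun b _ => ?_
    rw [(M.factor_commute_site hi _ _).eq, ← mul_assoc, contraction_mul_site h, mul_assoc,
      (M.factor_commute_site hj _ _).eq]
  rw [mul_add, h1, casimirSum_factor_tau, omega]
  exact mul_neg_add_mul _ _

theorem omega_mul_contraction {s : Option (Fin k)} {i j : Fin k} (h : i ≠ j) :
    (M.omega k s i + M.omega k s j) * contraction G k X i j = 0 := by
  have h1 : M.omega k s i * contraction G k X i j =
      casimirSum (M.factor k s ∘ₗ G.skew) ((site G k X j).toLinearMap ∘ₗ G.tau) *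
        contraction G k X i j := by
    simp only [omega, casimirSum, Finset.sum_mul, AlgHom.toLinearMap_apply, LinearMap.comp_apply]
    refine Finset.sum_congr rfl fun a _ => Finset.sum_congr rfl fun b _ => ?_
    rw [mul_assoc, site_mul_contraction h, mul_assoc]
  rw [add_mul, h1, casimirSum_factor_tau, omega]
  exact neg_mul_add_mul _ _

theorem contraction_mul_factor {i j : Fin k} (h : i ≠ j) (x : G.lieAlg) :
    contraction G k X i j * (M.factor k (some i) x + M.factor k (some j) x) = 0 := by
  rw [factor_some, factor_some, mul_add, contraction_mul_site h, (G.mem_lieAlg_iff_tau _).1 x.2,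
    map_neg]
  exact mul_neg_add_mul _ _

theorem factor_mul_contraction {i j : Fin k} (h : i ≠ j) (x : G.lieAlg) :
    (M.factor k (some i) x + M.factor k (some j) x) * contraction G k X i j = 0 := by
  rw [factor_some, factor_some, add_mul, site_mul_contraction h, (G.mem_lieAlg_iff_tau _).1 x.2,
    map_neg]
  exact neg_mul_add_mul _ _

theorem contraction_commute_omega {i j l : Fin k} (hij : i ≠ j) (hil : i ≠ l) (hjl : j ≠ l) :
    Commute (contraction G k X i j) (M.omega k (some i) l + M.omega k (some j) l) := by
  have h1 : M.omega k (some i) l + M.omega k (some j) l =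
      casimirSum ((M.factor k (some i) + M.factor k (some j)) ∘ₗ G.skew)
        (site G k X l).toLinearMap := by
    rw [LinearMap.add_comp, casimirSum_add_left]; rfl
  rw [h1]
  refine commute_casimirSum _ _ _ (fun A => ?_) fun A => ?_
  · change _ * (M.factor k (some i) (G.skew A) + M.factor k (some j) (G.skew A)) =
      (M.factor k (some i) (G.skew A) + M.factor k (some j) (G.skew A)) * _
    rw [contraction_mul_factor _ hij, factor_mul_contraction _ hij]
  · exact (commute_contraction _ (fun _ => site_commute hil.symm _ _)
      (fun _ => site_commute hjl.symm _ _)).symm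

/-- `Ω_{s,i}` commutes with the diagonal action of `𝔤` on the factors `s` and `i`. -/
theorem factor_commute_omega {s : Option (Fin k)} {i : Fin k} (h : s ≠ some i) (x : G.lieAlg) :
    Commute (M.factor k s x + M.factor k (some i) x) (M.omega k s i) := by
  set x' : Matrix G.Idx G.Idx ℂ := (x : Matrix G.Idx G.Idx ℂ) with hx'
  have e1 := casimirSum_mul_left (M.factor k s ∘ₗ G.skew) (site G k X i).toLinearMap x'
  have e2 := casimirSum_mul_right (M.factor k s ∘ₗ G.skew) (site G k X i).toLinearMap x'
  have h1 : ∀ B, M.factor k s x * (M.factor k s ∘ₗ G.skew) B =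
      (M.factor k s ∘ₗ G.skew) B * M.factor k s x +
        ((M.factor k s ∘ₗ G.skew) (x' * B) - (M.factor k s ∘ₗ G.skew) (B * x')) := by
    intro B
    rw [← map_sub, LinearMap.comp_apply, LinearMap.comp_apply, ← lie_skew, factor_lie]
    abel
  rw [Commute, SemiconjBy, add_mul, mul_add]
  have h2 : M.factor k s x * M.omega k s i = M.omega k s i * M.factor k s x +
      (∑ a, ∑ b, (M.factor k s ∘ₗ G.skew) (x' * Matrix.single a b 1) *
          (site G k X i).toLinearMap (Matrix.single b a 1) -
        ∑ a, ∑ b, (M.factor k s ∘ₗ G.skew) (Matrix.single a b 1 * x') *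
          (site G k X i).toLinearMap (Matrix.single b a 1)) := by
    simp only [omega, casimirSum, Finset.mul_sum, Finset.sum_mul, ← Finset.sum_add_distrib,
      ← Finset.sum_sub_distrib]
    refine Finset.sum_congr rfl fun a _ => Finset.sum_congr rfl fun b _ => ?_
    rw [← mul_assoc, h1, add_mul, mul_assoc, AlgHom.toLinearMap_apply,
      (M.factor_commute_site h _ _).eq, ← mul_assoc, sub_mul]
  have h3 : M.factor k (some i) x * M.omega k s i = M.omega k s i * M.factor k (some i) x +
      (∑ a, ∑ b, (M.factor k s ∘ₗ G.skew) (Matrix.single a b 1) *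
          (site G k X i).toLinearMap (x' * Matrix.single b a 1) -
        ∑ a, ∑ b, (M.factor k s ∘ₗ G.skew) (Matrix.single a b 1) *
          (site G k X i).toLinearMap (Matrix.single b a 1 * x')) := by
    simp only [omega, casimirSum, Finset.mul_sum, Finset.sum_mul, ← Finset.sum_add_distrib,
      ← Finset.sum_sub_distrib]
    refine Finset.sum_congr rfl fun a _ => Finset.sum_congr rfl fun b _ => ?_
    rw [factor_some, ← hx', ← mul_assoc, LinearMap.comp_apply,
      ← (M.factor_commute_site h _ _).eq, mul_assoc, mul_assoc, AlgHom.toLinearMap_apply,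
      AlgHom.toLinearMap_apply, AlgHom.toLinearMap_apply, ← map_mul, ← map_mul]
    noncomm_ring
  rw [h2, h3, e1, e2]
  abel

theorem omega_commute {s : Option (Fin k)} {i j : Fin k} (hsi : s ≠ some i) (hsj : s ≠ some j)
    (hij : i ≠ j) : Commute (M.omega k s i) (M.omega k s j + M.omega k (some i) j) := by
  have h1 : M.omega k s j + M.omega k (some i) j =
      casimirSum ((M.factor k s + M.factor k (some i)) ∘ₗ G.skew)
        (site G k X j).toLinearMap := by
    rw [LinearMap.add_comp, casimirSum_add_left]; rfl
  rw [h1]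
  refine commute_casimirSum _ _ _ (fun A => ?_) fun A => ?_
  · exact (M.factor_commute_omega hsi (G.skew A)).symm
  · exact (M.commute_omega _ (fun x => (M.factor_commute_site hsj _ _).symm)
      fun B => site_commute hij.symm _ _).symm

theorem omega_commute_omega {s u : Option (Fin k)} {i j : Fin k} (hsu : s ≠ u)
    (hsj : s ≠ some j) (hui : u ≠ some i) (hij : i ≠ j) :
    Commute (M.omega k s i) (M.omega k u j) := by
  refine M.commute_omega _ (fun x => ?_) fun A => ?_
  · exact (M.commute_omega _ (fun y => (M.factor_commute_factor hsu _ _).symm)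
      fun B => M.factor_commute_site hui _ _).symm
  · exact (M.commute_omega _ (fun y => (M.factor_commute_site hsj _ _).symm)
      fun B => site_commute hij.symm _ _).symm

theorem mem_leftOf {s : Option (Fin k)} {j : Fin k} :
    s ∈ leftOf k j ↔ ∀ i, s = some i → i < j := by
  simp [leftOf, Finset.mem_insertNone]

theorem ne_of_mem_leftOf {s : Option (Fin k)} {i j : Fin k} (hs : s ∈ leftOf k j) (hij : j ≤ i) :
    s ≠ some i := fun h => absurd (mem_leftOf.1 hs i h) (not_lt.2 hij)

theorem commute_zOp {j : Fin k} (T : Module.End ℂ (G.TensorSpace k X))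
    (h : Commute T (∑ s ∈ leftOf k j, M.omega k s j)) : Commute T (M.zOp k j) :=
  (h.add_right ((Commute.one_right _).smul_right _)).smul_right _

theorem zOp_commute_of_lt {i j : Fin k} (hij : i < j) : Commute (M.zOp k i) (M.zOp k j) := by
  refine M.commute_zOp _ (M.commute_zOp _ ?_).symm
  refine Commute.sum_right _ _ _ fun s hs => ?_
  have hsi : s ≠ some i := ne_of_mem_leftOf hs le_rfl
  have hsj : s ≠ some j := ne_of_mem_leftOf hs hij.le
  have h1 : s ∈ leftOf k j := mem_leftOf.2 fun l hl => (mem_leftOf.1 hs l hl).trans hij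
  have h2 : some i ∈ (leftOf k j).erase s :=
    Finset.mem_erase.2 ⟨hsi.symm, mem_leftOf.2 fun l hl => by cases hl; exact hij⟩
  rw [← Finset.add_sum_erase _ _ h1, ← Finset.add_sum_erase _ _ h2, ← add_assoc]
  refine ((M.omega_commute hsi hsj hij.ne).add_right ?_).symm
  refine Commute.sum_right _ _ _ fun u hu => ?_
  rw [Finset.mem_erase, Finset.mem_erase] at hu
  exact M.omega_commute_omega hu.2.1.symm hsj hu.1 hij.ne

theorem zOp_commute (i j : Fin k) : Commute (M.zOp k i) (M.zOp k j) := by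
  rcases lt_trichotomy i j with h | rfl | h
  · exact M.zOp_commute_of_lt h
  · exact Commute.refl _
  · exact (M.zOp_commute_of_lt h).symm

theorem site_commute_zOp {i j : Fin k} (h : j < i) (A : Matrix G.Idx G.Idx ℂ) :
    Commute (site G k X i A) (M.zOp k j) := by
  refine M.commute_zOp _ (Commute.sum_right _ _ _ fun s hs => ?_)
  exact M.commute_omega _ (fun x => (M.factor_commute_site (ne_of_mem_leftOf hs h.le) _ _).symm)
    fun B => site_commute h.ne' _ _

theorem contraction_commute_zOp {i i' j : Fin k} (hii : i < i') (h : j < i ∨ i' < j) :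
    Commute (contraction G k X i i') (M.zOp k j) := by
  rcases h with h | h
  · exact (commute_contraction _ (fun _ => (M.site_commute_zOp h _).symm)
      (fun _ => (M.site_commute_zOp (h.trans hii) _).symm)).symm
  · refine M.commute_zOp _ ?_
    have h1 : some i ∈ leftOf k j := mem_leftOf.2 fun l hl => by cases hl; exact hii.trans h
    have h2 : some i' ∈ (leftOf k j).erase (some i) :=
      Finset.mem_erase.2 ⟨fun h' => hii.ne' (Option.some.inj h'),
        mem_leftOf.2 fun l hl => by cases hl; exact h⟩
    rw [← Finset.add_sum_erase _ _ h1, ← Finset.add_sum_erase _ _ h2, ← add_assoc]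
    refine (M.contraction_commute_omega hii.ne (hii.trans h).ne h.ne).add_right ?_
    refine Commute.sum_right _ _ _ fun u hu => ?_
    rw [Finset.mem_erase, Finset.mem_erase] at hu
    refine M.commute_omega _ (fun x => ?_) fun A => ?_
    · exact (commute_contraction _ (fun _ => M.factor_commute_site hu.2.1 _ _)
        (fun _ => M.factor_commute_site hu.1 _ _)).symm
    · exact (commute_contraction _ (fun _ => site_commute (hii.trans h).ne' _ _)
        (fun _ => site_commute h.ne' _ _)).symm

theorem leftOf_succ {i i' : Fin k} (h : (i' : ℕ) = i + 1) :
    leftOf k i' = insert (some i) (leftOf k i) := by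
  ext s
  rw [Finset.mem_insert, mem_leftOf, mem_leftOf]
  cases s with
  | none => simp
  | some l =>
    have h1 : ∀ j : Fin k, (∀ m, some l = some m → m < j) ↔ (l : ℕ) < j := fun j =>
      ⟨fun h => h l rfl, fun h m hm => by cases hm; exact h⟩
    rw [h1, h1, Option.some.injEq, Fin.ext_iff]
    omega

theorem map_swap_of_mem_leftOf {i i' j : Fin k} {s : Option (Fin k)} (hs : s ∈ leftOf k j)
    (hi : j ≤ i) (hi' : j ≤ i') : s.map (Equiv.swap i i') = s := by
  cases s with
  | none => rfl
  | some l =>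
    have hl := mem_leftOf.1 hs l rfl
    rw [Option.map_some, Equiv.swap_apply_of_ne_of_ne (hl.trans_le hi).ne (hl.trans_le hi').ne]

theorem perm_swap_mul_zOp {i i' : Fin k} (h : (i' : ℕ) = i + 1) :
    ((G.eps : ℂ) • perm G k X (Equiv.swap i i')) * M.zOp k i -
      M.zOp k i' * ((G.eps : ℂ) • perm G k X (Equiv.swap i i')) =
      contraction G k X i i' - 1 := by
  have hlt : i < i' := by rw [Fin.lt_def]; omega
  have hs : some i ∉ leftOf k i := fun h' => lt_irrefl _ (mem_leftOf.1 h' i rfl)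
  have h1 : perm G k X (Equiv.swap i i') * ∑ s ∈ leftOf k i, M.omega k s i =
      (∑ s ∈ leftOf k i, M.omega k s i') * perm G k X (Equiv.swap i i') := by
    rw [Finset.mul_sum, Finset.sum_mul]
    refine Finset.sum_congr rfl fun s hs => ?_
    rw [perm_mul_omega, map_swap_of_mem_leftOf hs le_rfl hlt.le, Equiv.swap_apply_left]
  have h2 : perm G k X (Equiv.swap i i') * perm G k X (Equiv.swap i i') = 1 := by
    rw [← perm_mul, Equiv.swap_mul_self, perm_one]
  rw [zOp, zOp, leftOf_succ h, Finset.sum_insert hs, smul_mul_smul_comm, smul_mul_smul_comm,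
    epsC_mul_epsC, one_smul, one_smul, mul_add, h1, add_mul, add_mul, M.omega_some hlt.ne, sub_mul,
    smul_mul_assoc, contraction_mul_perm_swap hlt.ne, h2, smul_smul, epsC_mul_epsC, one_smul,
    mul_smul_comm, smul_mul_assoc, mul_one, one_mul]
  abel

theorem swap_commute_zOp {i i' j : Fin k} (h : (i' : ℕ) = i + 1) (hi : j ≠ i) (hi' : j ≠ i') :
    Commute (perm G k X (Equiv.swap i i')) (M.zOp k j) := by
  refine M.commute_zOp _ ?_
  rw [Commute, SemiconjBy, Finset.mul_sum, Finset.sum_mul]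
  have hj : Equiv.swap i i' j = j := Equiv.swap_apply_of_ne_of_ne hi hi'
  have hmem : ∀ s ∈ leftOf k j, s.map (Equiv.swap i i') ∈ leftOf k j := by
    intro s hs
    rw [mem_leftOf] at hs ⊢
    cases s with
    | none => simp
    | some l =>
      have hl := hs l rfl
      intro m hm
      rw [Option.map_some, Option.some.injEq, Equiv.swap_apply_def] at hm
      rw [Fin.lt_def] at hl ⊢
      rw [ne_eq, Fin.ext_iff] at hi hi'
      split_ifs at hm with h1 h2
      · subst h1 hm; omega
      · subst h2 hm; omega
      · subst hm; exact hl
  refine Finset.sum_nbij' (fun s => s.map (Equiv.swap i i')) (fun s => s.map (Equiv.swap i i'))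
    hmem hmem (fun s _ => ?_) (fun s _ => ?_) fun s _ => ?_
  · cases s <;> simp
  · cases s <;> simp
  · rw [perm_mul_omega, hj]

theorem contraction_mul_zOp {i i' : Fin k} (h : (i' : ℕ) = i + 1) :
    contraction G k X i i' * (M.zOp k i + M.zOp k i') = 0 := by
  have hlt : i < i' := by rw [Fin.lt_def]; omega
  have hs : some i ∉ leftOf k i := fun h' => lt_irrefl _ (mem_leftOf.1 h' i rfl)
  have h1 : contraction G k X i i' * (∑ s ∈ leftOf k i, (M.omega k s i + M.omega k s i')) = 0 := by
    rw [Finset.mul_sum]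
    refine Finset.sum_eq_zero fun s hs => ?_
    exact M.contraction_mul_omega hlt.ne (ne_of_mem_leftOf hs le_rfl) (ne_of_mem_leftOf hs hlt.le)
  rw [Finset.sum_add_distrib] at h1
  set c : ℂ := (((G.dim - G.eps) / 2 : ℝ) : ℂ) with hc
  have h2 : M.zOp k i + M.zOp k i' = (G.eps : ℂ) • ((∑ s ∈ leftOf k i, M.omega k s i +
      ∑ s ∈ leftOf k i, M.omega k s i') + (M.omega k (some i) i' + (2 * c) • 1)) := by
    rw [zOp, zOp, leftOf_succ h, Finset.sum_insert hs, ← smul_add, ← hc]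
    congr 1
    module
  have h3 := congrArg (fun r : ℝ => (r : ℂ)) G.eps_mul_eps
  rw [h2, mul_smul_comm, mul_add, h1, zero_add, M.omega_some hlt.ne, mul_add, mul_sub,
    contraction_mul_perm_swap hlt.ne, mul_smul_comm, contraction_sq hlt.ne, mul_smul_comm, mul_one,
    smul_smul]
  have h4 : (G.eps : ℂ) * ((G.eps : ℂ) - G.eps * ((G.eps * G.dim : ℝ) : ℂ) + 2 * c) = 0 := by
    rw [hc]
    push_cast at h3 ⊢
    linear_combination (-(G.dim : ℂ) * G.eps) * h3
  refine (congrArg _ (smul_sub_smul_add_smul _ _ _ _)).trans ?_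
  rw [smul_smul, h4, zero_smul]

theorem zOp_mul_contraction {i i' : Fin k} (h : (i' : ℕ) = i + 1) :
    (M.zOp k i + M.zOp k i') * contraction G k X i i' = 0 := by
  have hlt : i < i' := by rw [Fin.lt_def]; omega
  have hs : some i ∉ leftOf k i := fun h' => lt_irrefl _ (mem_leftOf.1 h' i rfl)
  have h1 : (∑ s ∈ leftOf k i, (M.omega k s i + M.omega k s i')) * contraction G k X i i' = 0 := by
    rw [Finset.sum_mul]
    refine Finset.sum_eq_zero fun s _ => ?_
    exact M.omega_mul_contraction hlt.ne
  rw [Finset.sum_add_distrib] at h1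
  set c : ℂ := (((G.dim - G.eps) / 2 : ℝ) : ℂ) with hc
  have h2 : M.zOp k i + M.zOp k i' = (G.eps : ℂ) • ((∑ s ∈ leftOf k i, M.omega k s i +
      ∑ s ∈ leftOf k i, M.omega k s i') + (M.omega k (some i) i' + (2 * c) • 1)) := by
    rw [zOp, zOp, leftOf_succ h, Finset.sum_insert hs, ← smul_add, ← hc]
    congr 1
    module
  have h3 := congrArg (fun r : ℝ => (r : ℂ)) G.eps_mul_eps
  rw [h2, smul_mul_assoc, add_mul, h1, zero_add, M.omega_some hlt.ne, add_mul, sub_mul,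
    perm_swap_mul_contraction hlt.ne, smul_mul_assoc, contraction_sq hlt.ne, smul_mul_assoc,
    one_mul, smul_smul]
  have h4 : (G.eps : ℂ) * ((G.eps : ℂ) - G.eps * ((G.eps * G.dim : ℝ) : ℂ) + 2 * c) = 0 := by
    rw [hc]
    push_cast at h3 ⊢
    linear_combination (-(G.dim : ℂ) * G.eps) * h3
  refine (congrArg _ (smul_sub_smul_add_smul _ _ _ _)).trans ?_
  rw [smul_smul, h4, zero_smul]

end GKModule

namespace GKModule
open ClassicalGroup

/-- `Ω_{s,j}` in terms of an arbitrary basis of `𝔤` and its dual basis for `(x, y) ↦ tr(xy) / 2`. -/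
theorem omega_eq_sum {G : ClassicalGroup} {X : Type*} [AddCommGroup X] [Module ℂ X]
    (M : GKModule G X) (k : ℕ) {ι : Type*} [Fintype ι] [DecidableEq ι]
    (b : Module.Basis ι ℂ G.lieAlg) (b' : ι → G.lieAlg)
    (hb : ∀ i j, ((b i : Matrix G.Idx G.Idx ℂ) * (b' j : Matrix G.Idx G.Idx ℂ)).trace / 2 =
      if i = j then 1 else 0) (s : Option (Fin k)) (j : Fin k) :
    M.omega k s j =
      ∑ i, M.factor k s (b i) * site G k X j (b' i : Matrix G.Idx G.Idx ℂ) := by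
  have h1 : ∀ (x : G.lieAlg) (i : ι),
      b.repr x i = ((x : Matrix G.Idx G.Idx ℂ) * (b' i : Matrix G.Idx G.Idx ℂ)).trace / 2 := by
    intro x i
    let f : G.lieAlg →ₗ[ℂ] ℂ := (1 / 2 : ℂ) • (Matrix.traceLinearMap G.Idx ℂ ℂ ∘ₗ
      LinearMap.mulRight ℂ (b' i : Matrix G.Idx G.Idx ℂ) ∘ₗ G.lieAlg.toSubmodule.subtype)
    have hf : ∀ y : G.lieAlg,
        f y = ((y : Matrix G.Idx G.Idx ℂ) * (b' i : Matrix G.Idx G.Idx ℂ)).trace / 2 := by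
      intro y
      change (1 / 2 : ℂ) * ((y : Matrix G.Idx G.Idx ℂ) * (b' i : Matrix G.Idx G.Idx ℂ)).trace = _
      ring
    have h : b.coord i = f := by
      refine b.ext fun l => ?_
      rw [hf, hb, Module.Basis.coord_apply, Module.Basis.repr_self, Finsupp.single_apply]
    rw [← hf, ← h, Module.Basis.coord_apply]
  have h2 : ∀ (A : Matrix G.Idx G.Idx ℂ) (i : ι), b.repr (G.skew A) i =
      (A * (b' i : Matrix G.Idx G.Idx ℂ)).trace := by
    intro A i
    have hy := (G.mem_lieAlg_iff_tau _).1 (b' i).2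
    have ht : ∀ B : Matrix G.Idx G.Idx ℂ, (G.tau B).trace = B.trace := by
      intro B
      rw [tau_apply, Matrix.trace_mul_comm, ← Matrix.mul_assoc, Jc_mul_Jc_transpose,
        Matrix.one_mul, Matrix.trace_transpose]
    have h3 : (G.tau A * (b' i : Matrix G.Idx G.Idx ℂ)).trace =
        -(A * (b' i : Matrix G.Idx G.Idx ℂ)).trace := by
      rw [← ht (G.tau A * _), tau_mul, tau_tau, hy, Matrix.neg_mul, Matrix.trace_neg,
        Matrix.trace_mul_comm]
    rw [h1, skew_coe, Matrix.sub_mul, Matrix.trace_sub, h3]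
    ring
  have h4 : ∀ A : Matrix G.Idx G.Idx ℂ, M.factor k s (G.skew A) =
      ∑ i, (A * (b' i : Matrix G.Idx G.Idx ℂ)).trace • M.factor k s (b i) := by
    intro A
    conv_lhs => rw [← b.sum_repr (G.skew A)]
    simp only [map_sum, map_smul, h2]
  simp only [omega, casimirSum, LinearMap.comp_apply, AlgHom.toLinearMap_apply, h4,
    Finset.sum_mul, smul_mul_assoc]
  simp_rw [Finset.sum_comm (t := (Finset.univ : Finset ι))]
  refine Finset.sum_congr rfl fun i _ => ?_
  conv_rhs => rw [Matrix.matrix_eq_sum_single (b' i : Matrix G.Idx G.Idx ℂ)]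
  simp only [map_sum, Finset.mul_sum]
  rw [Finset.sum_comm]
  refine Finset.sum_congr rfl fun c _ => Finset.sum_congr rfl fun a _ => ?_
  have h5 : Matrix.single c a ((b' i : Matrix G.Idx G.Idx ℂ) c a) =
      (b' i : Matrix G.Idx G.Idx ℂ) c a • Matrix.single c a (1 : ℂ) := by
    rw [Matrix.smul_single, smul_eq_mul, mul_one]
  rw [h5, map_smul, mul_smul_comm]
  congr 1
  simp [Matrix.trace, Matrix.mul_apply, Matrix.single_apply, ite_and]

end GKModule

/-- The generators `t_{i,i+1}`, `e_{i,i+1}`, `z_i`, `θ_i` of the type `B/C` VW-algebra. -/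
inductive VWGen (k : ℕ) : Type
  | t (i j : Fin k) (h : (j : ℕ) = i + 1)
  | e (i j : Fin k) (h : (j : ℕ) = i + 1)
  | z (i : Fin k)
  | theta (i : Fin k)

namespace VWGen

variable {k : ℕ}

/-- `t_{i,i+1}` in the free algebra. -/
noncomputable abbrev T (i j : Fin k) (h : (j : ℕ) = i + 1) : FreeAlgebra ℂ (VWGen k) :=
  FreeAlgebra.ι ℂ (t i j h)

/-- `e_{i,i+1}` in the free algebra. -/
noncomputable abbrev E (i j : Fin k) (h : (j : ℕ) = i + 1) : FreeAlgebra ℂ (VWGen k) :=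
  FreeAlgebra.ι ℂ (e i j h)

/-- `z_i` in the free algebra. -/
noncomputable abbrev Z (i : Fin k) : FreeAlgebra ℂ (VWGen k) := FreeAlgebra.ι ℂ (z i)

/-- `θ_i` in the free algebra. -/
noncomputable abbrev Th (i : Fin k) : FreeAlgebra ℂ (VWGen k) := FreeAlgebra.ι ℂ (theta i)

end VWGen

open VWGen in
/-- The defining relations of the type `B/C` VW-algebra with parameters `m₀`, `m₁` and sign `ε`.
The set `W` lists the pairs `(l, w)` for which a relation `e_{1,2} z_1^l e_{1,2} = w e_{1,2}` is
imposed.  (The indices here start at `0`.) -/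
inductive VWRel (k : ℕ) (m₀ m₁ ε : ℝ) (W : Set (ℕ × ℝ)) :
    FreeAlgebra ℂ (VWGen k) → FreeAlgebra ℂ (VWGen k) → Prop
  -- the hyperoctahedral group
  | t_sq (i j h) : VWRel k m₀ m₁ ε W (T i j h * T i j h) 1
  | t_braid (i j l h h') :
      VWRel k m₀ m₁ ε W (T i j h * T j l h' * T i j h) (T j l h' * T i j h * T j l h')
  | t_t (i j h i' j' h') (hlt : j < i') :
      VWRel k m₀ m₁ ε W (T i j h * T i' j' h') (T i' j' h' * T i j h)
  | theta_sq (i) : VWRel k m₀ m₁ ε W (Th i * Th i) 1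
  | theta_theta (i j) : VWRel k m₀ m₁ ε W (Th i * Th j) (Th j * Th i)
  | t_theta_t (i j h) : VWRel k m₀ m₁ ε W (T i j h * Th i * T i j h) (Th j)
  | t_theta (i j h l) (hi : l ≠ i) (hj : l ≠ j) :
      VWRel k m₀ m₁ ε W (T i j h * Th l) (Th l * T i j h)
  -- the Brauer algebra
  | e_sq (i j h) : VWRel k m₀ m₁ ε W (E i j h * E i j h) ((m₀ : ℂ) • E i j h)
  | t_e (i j h) : VWRel k m₀ m₁ ε W (T i j h * E i j h) (E i j h)
  | e_t (i j h) : VWRel k m₀ m₁ ε W (E i j h * T i j h) (E i j h)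
  | t_t_e_t_t (i j l h h') :
      VWRel k m₀ m₁ ε W (T i j h * T j l h' * E i j h * T j l h' * T i j h) (E j l h')
  | e_t_e (i j l h h') : VWRel k m₀ m₁ ε W (E i j h * T j l h' * E i j h) (E i j h)
  | t_e_far (i j h i' j' h') (hfar : j < i' ∨ j' < i) :
      VWRel k m₀ m₁ ε W (T i j h * E i' j' h') (E i' j' h' * T i j h)
  | e_e_far (i j h i' j' h') (hfar : j < i') :
      VWRel k m₀ m₁ ε W (E i j h * E i' j' h') (E i' j' h' * E i j h)
  -- the polynomial generators
  | z_z (i j) : VWRel k m₀ m₁ ε W (Z i * Z j) (Z j * Z i)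
  | t_z (i j h) :
      VWRel k m₀ m₁ ε W (T i j h * Z i - Z j * T i j h) (E i j h - 1)
  | t_z_far (i j h l) (hi : l ≠ i) (hj : l ≠ j) :
      VWRel k m₀ m₁ ε W (T i j h * Z l) (Z l * T i j h)
  | e_z (i j h) : VWRel k m₀ m₁ ε W (E i j h * (Z i + Z j)) 0
  | z_e (i j h) : VWRel k m₀ m₁ ε W ((Z i + Z j) * E i j h) 0
  | e_z_far (i j h l) (hi : l ≠ i) (hj : l ≠ j) :
      VWRel k m₀ m₁ ε W (E i j h * Z l) (Z l * E i j h)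
  | e_z_e (i j : Fin k) (h l w) (hi : (i : ℕ) = 0) (hw : (l, w) ∈ W) :
      VWRel k m₀ m₁ ε W (E i j h * Z i ^ l * E i j h) ((w : ℂ) • E i j h)
  -- relations between the `θ_j` and the other generators
  | e_theta (i j h l) (hi : l ≠ i) (hj : l ≠ j) :
      VWRel k m₀ m₁ ε W (E i j h * Th l) (Th l * E i j h)
  | e_theta_theta (i j h) :
      VWRel k m₀ m₁ ε W (E i j h * Th i * Th j) ((ε : ℂ) • E i j h)
  | theta_theta_e (i j h) :
      VWRel k m₀ m₁ ε W (Th i * Th j * E i j h) ((ε : ℂ) • E i j h)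
  | e_theta_e (i j h) :
      VWRel k m₀ m₁ ε W (E i j h * Th i * E i j h) ((m₁ : ℂ) • E i j h)
  | theta_z (i j : Fin k) (hi : (i : ℕ) + 1 = k) (hj : j ≠ i) :
      VWRel k m₀ m₁ ε W (Th i * Z j) (Z j * Th i)

/-- The type `B/C` VW-algebra. -/
abbrev VWAlgebra (k : ℕ) (m₀ m₁ ε : ℝ) (W : Set (ℕ × ℝ)) : Type :=
  RingQuot (VWRel k m₀ m₁ ε W)

/-- The conjugate opposite of a complex algebra: the opposite ring, with scalars acting through
complex conjugation.  An algebra homomorphism `A → ConjOp A` is a conjugate linear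
antihomomorphism `A → A`. -/
def ConjOp (A : Type*) : Type _ := Aᵐᵒᵖ

namespace ConjOp

theorem exchange_relation {R : Type*} [Ring R] (t z z' e : R) (h1 : t * t = 1)
    (h2 : t * z - z' * t = e - 1) (h3 : e * t = e) (h4 : t * e = e) :
    z * t - t * z' = e - 1 :=
  calc z * t - t * z' = (t * t) * z * t - t * z' * (t * t) := by rw [h1]; noncomm_ring
    _ = t * (t * z - z' * t) * t := by noncomm_ring
    _ = (t * e) * t - t * t := by rw [h2]; noncomm_ring
    _ = e - 1 := by rw [h4, h3, h1]

section

variable {A : Type*} [Ring A]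

instance : Ring (ConjOp A) := inferInstanceAs (Ring Aᵐᵒᵖ)

/-- The identity map `A → ConjOp A`. -/
def mk (a : A) : ConjOp A := MulOpposite.op a

/-- The identity map `ConjOp A → A`. -/
def out (a : ConjOp A) : A := MulOpposite.unop a

theorem mk_mul (a b : A) : mk a * mk b = mk (b * a) := rfl

theorem mk_add (a b : A) : mk a + mk b = mk (a + b) := rfl

theorem mk_sub (a b : A) : mk a - mk b = mk (a - b) := rfl

theorem mk_one : (1 : ConjOp A) = mk 1 := rfl

theorem mk_zero : (0 : ConjOp A) = mk 0 := rfl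

theorem mk_pow (a : A) (n : ℕ) : mk a ^ n = mk (a ^ n) := rfl

theorem out_mul (a b : ConjOp A) : (a * b).out = b.out * a.out := rfl

theorem out_add (a b : ConjOp A) : (a + b).out = a.out + b.out := rfl

end

variable {A : Type*} [Ring A] [Algebra ℂ A]

noncomputable instance : Algebra ℂ (ConjOp A) :=
  ((algebraMap ℂ Aᵐᵒᵖ).comp (starRingEnd ℂ)).toAlgebra' (by
    intro c x
    exact Algebra.commutes (A := Aᵐᵒᵖ) ((starRingEnd ℂ) c) x)

theorem real_smul_mk (r : ℝ) (a : A) : (r : ℂ) • mk a = mk ((r : ℂ) • a) := by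
  rw [Algebra.smul_def]
  change MulOpposite.op (algebraMap ℂ A ((starRingEnd ℂ) r)) * MulOpposite.op a = _
  rw [Complex.conj_ofReal, ← MulOpposite.op_mul, ← Algebra.commutes, ← Algebra.smul_def]
  rfl

theorem out_smul (c : ℂ) (a : ConjOp A) : (c • a).out = (starRingEnd ℂ) c • a.out := by
  rw [Algebra.smul_def]
  change a.out * algebraMap ℂ A ((starRingEnd ℂ) c) = _
  rw [← Algebra.commutes, ← Algebra.smul_def]

end ConjOp

namespace VWAlgebra

variable {k : ℕ} {m₀ m₁ ε : ℝ} {W : Set (ℕ × ℝ)}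

/-- The image of a generator in the type `B/C` VW-algebra. -/
noncomputable def gen (g : VWGen k) : VWAlgebra k m₀ m₁ ε W :=
  RingQuot.mkAlgHom ℂ (VWRel k m₀ m₁ ε W) (FreeAlgebra.ι ℂ g)

theorem mk_eq {a b : FreeAlgebra ℂ (VWGen k)} (h : VWRel k m₀ m₁ ε W a b) :
    RingQuot.mkAlgHom ℂ (VWRel k m₀ m₁ ε W) a = RingQuot.mkAlgHom ℂ (VWRel k m₀ m₁ ε W) b :=
  RingQuot.mkAlgHom_rel ℂ h

/-- The conjugate linear antihomomorphism `•` that fixes the generators (so `g^• = g⁻¹` for `g` in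
the hyperoctahedral group). -/
noncomputable def bullet : VWAlgebra k m₀ m₁ ε W →ₐ[ℂ] ConjOp (VWAlgebra k m₀ m₁ ε W) :=
  RingQuot.liftAlgHom ℂ ⟨FreeAlgebra.lift ℂ fun g => ConjOp.mk (gen g), by
    intro a b hab
    have hr := fun {a b} (h : VWRel k m₀ m₁ ε W a b) => mk_eq h
    cases hab
    all_goals simp only [map_mul, map_add, map_sub, map_one, map_zero, map_smul, map_pow,
      FreeAlgebra.lift_ι_apply, ConjOp.mk_mul, ConjOp.mk_add, ConjOp.mk_sub, ConjOp.mk_one,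
      ConjOp.mk_zero, ConjOp.mk_pow, ConjOp.real_smul_mk]
    all_goals refine congrArg ConjOp.mk ?_
    case t_sq i j h => simpa [gen] using hr (.t_sq i j h)
    case t_braid i j l h h' => simpa [gen, mul_assoc] using hr (.t_braid i j l h h')
    case t_t i j h i' j' h' hlt => simpa [gen] using (hr (.t_t i j h i' j' h' hlt)).symm
    case theta_sq i => simpa [gen] using hr (.theta_sq i)
    case theta_theta i j => simpa [gen] using hr (.theta_theta j i)
    case t_theta_t i j h => simpa [gen, mul_assoc] using hr (.t_theta_t i j h)
    case t_theta i j h l hi hj => simpa [gen] using (hr (.t_theta i j h l hi hj)).symm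
    case e_sq i j h =>
      have h1 := hr (.e_sq i j h)
      simp only [map_mul, map_smul] at h1
      exact h1
    case t_e i j h => simpa [gen] using hr (.e_t i j h)
    case e_t i j h => simpa [gen] using hr (.t_e i j h)
    case t_t_e_t_t i j l h h' => simpa [gen, mul_assoc] using hr (.t_t_e_t_t i j l h h')
    case e_t_e i j l h h' => simpa [gen, mul_assoc] using hr (.e_t_e i j l h h')
    case t_e_far i j h i' j' h' hfar =>
      simpa [gen] using (hr (.t_e_far i j h i' j' h' hfar)).symm
    case e_e_far i j h i' j' h' hfar =>
      simpa [gen] using (hr (.e_e_far i j h i' j' h' hfar)).symm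
    case z_z i j => simpa [gen] using hr (.z_z j i)
    case t_z i j h =>
      have h1 := hr (.t_sq i j h)
      have h2 := hr (.t_z i j h)
      have h3 := hr (.e_t i j h)
      have h4 := hr (.t_e i j h)
      simp only [map_mul, map_sub, map_one] at h1 h2 h3 h4
      change gen (.z i) * gen (.t i j h) - gen (.t i j h) * gen (.z j) = gen (.e i j h) - 1
      change gen (.t i j h) * gen (.t i j h) = 1 at h1
      change gen (.t i j h) * gen (.z i) - gen (.z j) * gen (.t i j h) = gen (.e i j h) - 1 at h2
      change gen (.e i j h) * gen (.t i j h) = gen (.e i j h) at h3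
      change gen (.t i j h) * gen (.e i j h) = gen (.e i j h) at h4
      exact ConjOp.exchange_relation _ _ _ _ h1 h2 h3 h4
    case t_z_far i j h l hi hj => simpa [gen] using (hr (.t_z_far i j h l hi hj)).symm
    case e_z i j h => simpa [gen] using hr (.z_e i j h)
    case z_e i j h => simpa [gen] using hr (.e_z i j h)
    case e_z_far i j h l hi hj => simpa [gen] using (hr (.e_z_far i j h l hi hj)).symm
    case e_z_e i j h l w hi hw =>
      have h1 := hr (.e_z_e i j h l w hi hw)
      simp only [map_mul, map_smul, map_pow] at h1
      rw [mul_assoc] at h1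
      exact h1
    case e_theta i j h l hi hj => simpa [gen] using (hr (.e_theta i j h l hi hj)).symm
    case e_theta_theta i j h =>
      have h1 := hr (.theta_theta_e i j h)
      have h2 := hr (.theta_theta i j)
      simp only [map_mul, map_smul] at h1 h2
      rw [h2, mul_assoc] at h1
      exact h1
    case theta_theta_e i j h =>
      have h1 := hr (.e_theta_theta i j h)
      have h2 := hr (.theta_theta i j)
      simp only [map_mul, map_smul] at h1 h2
      rw [mul_assoc, h2] at h1
      exact h1
    case e_theta_e i j h =>
      have h1 := hr (.e_theta_e i j h)
      simp only [map_mul, map_smul] at h1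
      rw [mul_assoc] at h1
      exact h1
    case theta_z i j hi hj => simpa [gen] using (hr (.theta_z i j hi hj)).symm⟩

theorem bullet_gen (g : VWGen k) : (bullet (gen g : VWAlgebra k m₀ m₁ ε W)).out = gen g := by
  have h : bullet (gen g : VWAlgebra k m₀ m₁ ε W) = ConjOp.mk (gen g) := by
    rw [bullet]
    refine (RingQuot.liftAlgHom_mkAlgHom_apply _ _ _ _).trans ?_
    rw [FreeAlgebra.lift_ι_apply]
  rw [h]
  rfl

/-- The longest element `w₀ = θ_1 θ_2 ⋯ θ_k` of the hyperoctahedral group. -/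
noncomputable def w₀ : VWAlgebra k m₀ m₁ ε W := (List.ofFn fun i : Fin k => gen (.theta i)).prod

/-- The star operation `b^* = w₀ b^• w₀`. -/
noncomputable def starOp (b : VWAlgebra k m₀ m₁ ε W) : VWAlgebra k m₀ m₁ ε W :=
  w₀ * (bullet b).out * w₀

end VWAlgebra

namespace GKModule
open ClassicalGroup

variable {G : ClassicalGroup} {X : Type*} [AddCommGroup X] [Module ℂ X] (M : GKModule G X) (k : ℕ)

/-- The operators on `X ⊗ V^{⊗k}` by which the generators of the type `B/C` VW-algebra act. -/
noncomputable def genOp : VWGen k → Module.End ℂ (G.TensorSpace k X)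
  | .t i j _ => (G.eps : ℂ) • perm G k X (Equiv.swap i j)
  | .e i j _ => contraction G k X i j
  | .z i => M.zOp k i
  | .theta i => site G k X i G.xi

/-- The relations `e_{1,2} z_1^l e_{1,2} = w e_{1,2}` with `(l, w) ∈ W` hold on `X ⊗ V^{⊗k}`. -/
def Satisfies (W : Set (ℕ × ℝ)) : Prop :=
  ∀ lw ∈ W, ∀ (i j : Fin k), (i : ℕ) = 0 → (j : ℕ) = 1 →
    contraction G k X i j * M.zOp k i ^ lw.1 * contraction G k X i j =
      (lw.2 : ℂ) • contraction G k X i j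

/-- The type `B/C` VW-algebra `𝔅_k^θ` attached to `G`: the parameters are `m₀ = N` and
`m₁ = p - q` for `O(p,q)`, and `m₀ = -2n`, `m₁ = 0` for `Sp(2n, ℝ)`. -/
abbrev _root_.ClassicalGroup.VW (G : ClassicalGroup) (k : ℕ) (W : Set (ℕ × ℝ)) : Type :=
  VWAlgebra k (G.eps * G.dim) G.traceXi G.eps W

variable {k}

theorem eps_smul_mul_eps_smul (a b : Module.End ℂ (G.TensorSpace k X)) :
    ((G.eps : ℂ) • a) * ((G.eps : ℂ) • b) = a * b := by
  rw [smul_mul_smul_comm, epsC_mul_epsC, one_smul]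

theorem perm_swap_sq (i j : Fin k) :
    perm G k X (Equiv.swap i j) * perm G k X (Equiv.swap i j) = 1 := by
  rw [← perm_mul, Equiv.swap_mul_self, perm_one]

theorem site_xi_sq (i : Fin k) : site G k X i G.xi * site G k X i G.xi = 1 := by
  rw [← map_mul, xi_mul_xi, map_one]

theorem succ_ne {i j : Fin k} (h : (j : ℕ) = i + 1) : i ≠ j := fun h' => by
  rw [h'] at h; omega

/-- The action of `𝔅_k^θ` on `X ⊗ V^{⊗k}`. -/
noncomputable def action {W : Set (ℕ × ℝ)} (hW : M.Satisfies k W) :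
    G.VW k W →ₐ[ℂ] Module.End ℂ (G.TensorSpace k X) :=
  RingQuot.liftAlgHom ℂ ⟨FreeAlgebra.lift ℂ (M.genOp k), by
    intro a b hab
    cases hab
    all_goals simp only [map_mul, map_add, map_sub, map_one, map_zero, map_smul, map_pow,
      FreeAlgebra.lift_ι_apply, genOp]
    case t_sq i j h => rw [eps_smul_mul_eps_smul, perm_swap_sq]
    case t_braid i j l h h' =>
      rw [eps_smul_mul_eps_smul, eps_smul_mul_eps_smul, mul_smul_comm, mul_smul_comm, ← perm_mul,
        ← perm_mul, ← perm_mul, ← perm_mul]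
      congr 2
      have h1 : i ≠ j := succ_ne h
      have h2 : j ≠ l := succ_ne h'
      have h3 : i ≠ l := fun h3 => by subst h3; omega
      rw [Equiv.swap_mul_swap_mul_swap h1 h3, Equiv.swap_comm i j,
        Equiv.swap_comm j l, Equiv.swap_mul_swap_mul_swap h2.symm h3.symm, Equiv.swap_comm]
    case t_t i j h i' j' h' hlt =>
      rw [eps_smul_mul_eps_smul, eps_smul_mul_eps_smul, ← perm_mul, ← perm_mul]
      congr 1
      refine (Equiv.Perm.Disjoint.commute ?_).eq
      refine (Equiv.Perm.disjoint_swap_swap ?_)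
      have h1 := succ_ne h
      have h2 := succ_ne h'
      rw [Fin.lt_def] at hlt
      simp only [List.nodup_cons, List.mem_cons, List.not_mem_nil, or_false, not_or, Fin.ext_iff,
        List.nodup_nil, and_true, not_false_eq_true]
      omega
    case theta_sq i => rw [site_xi_sq]
    case theta_theta i j =>
      by_cases h : i = j
      · rw [h]
      · exact site_commute h _ _
    case t_theta_t i j h =>
      rw [smul_mul_assoc, perm_mul_site, Equiv.swap_apply_left, ← mul_smul_comm, mul_assoc,
        eps_smul_mul_eps_smul, perm_swap_sq, mul_one]
    case t_theta i j h l hi hj =>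
      rw [smul_mul_assoc, perm_mul_site, Equiv.swap_apply_of_ne_of_ne hi hj, mul_smul_comm]
    case e_sq i j h => exact contraction_sq (succ_ne h)
    case t_e i j h =>
      rw [smul_mul_assoc, perm_swap_mul_contraction (succ_ne h), smul_smul, epsC_mul_epsC,
        one_smul]
    case e_t i j h =>
      rw [mul_smul_comm, contraction_mul_perm_swap (succ_ne h), smul_smul, epsC_mul_epsC,
        one_smul]
    case t_t_e_t_t i j l h h' =>
      have h1 : i ≠ j := succ_ne h
      have h2 : j ≠ l := succ_ne h'
      have h3 : i ≠ l := fun h3 => by subst h3; omega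
      rw [eps_smul_mul_eps_smul, mul_assoc, mul_assoc, eps_smul_mul_eps_smul, ← perm_mul,
        ← mul_assoc, perm_mul_contraction, mul_assoc, ← perm_mul]
      have h4 : Equiv.swap i j * Equiv.swap j l * (Equiv.swap j l * Equiv.swap i j) = 1 := by
        rw [mul_assoc, ← mul_assoc (Equiv.swap j l), Equiv.swap_mul_self, one_mul,
          Equiv.swap_mul_self]
      rw [← perm_mul, h4, perm_one, mul_one, Equiv.Perm.mul_apply, Equiv.Perm.mul_apply,
        Equiv.swap_apply_left, Equiv.swap_apply_of_ne_of_ne h1 h3, Equiv.swap_apply_left,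
        Equiv.swap_apply_of_ne_of_ne h3.symm h2.symm]
    case e_t_e i j l h h' =>
      have h3 : i ≠ l := fun h3 => by subst h3; omega
      rw [mul_smul_comm, smul_mul_assoc, contraction_perm_contraction (succ_ne h) (succ_ne h') h3,
        smul_smul, epsC_mul_epsC, one_smul]
    case t_e_far i j h i' j' h' hfar =>
      rw [smul_mul_assoc, mul_smul_comm, perm_mul_contraction]
      have h1 : Equiv.swap i j i' = i' := by
        refine Equiv.swap_apply_of_ne_of_ne ?_ ?_ <;>
          (rw [ne_eq, Fin.ext_iff]; rw [Fin.lt_def, Fin.lt_def] at hfar; omega)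
      have h2 : Equiv.swap i j j' = j' := by
        refine Equiv.swap_apply_of_ne_of_ne ?_ ?_ <;>
          (rw [ne_eq, Fin.ext_iff]; rw [Fin.lt_def, Fin.lt_def] at hfar; omega)
      rw [h1, h2]
    case e_e_far i j h i' j' h' hfar =>
      rw [Fin.lt_def] at hfar
      refine commute_contraction _ (fun A => (commute_contraction _ (fun B => ?_) fun B => ?_).symm)
        fun A => (commute_contraction _ (fun B => ?_) fun B => ?_).symm
      all_goals
        refine site_commute ?_ _ _
        rw [ne_eq, Fin.ext_iff]
        omega
    case z_z i j => exact M.zOp_commute i j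
    case t_z i j h => exact M.perm_swap_mul_zOp h
    case t_z_far i j h l hi hj =>
      exact ((M.swap_commute_zOp h hi hj).smul_left _).eq
    case e_z i j h => exact M.contraction_mul_zOp h
    case z_e i j h => exact M.zOp_mul_contraction h
    case e_z_far i j h l hi hj =>
      refine M.contraction_commute_zOp ?_ ?_
      · rw [Fin.lt_def]; omega
      · rw [ne_eq, Fin.ext_iff] at hi hj
        rw [Fin.lt_def, Fin.lt_def]
        omega
    case e_z_e i j h l w hi hw => exact hW (l, w) hw i j hi (by omega)
    case e_theta i j h l hi hj =>
      exact (commute_contraction _ (fun _ => site_commute hi _ _)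
        fun _ => site_commute hj _ _).symm
    case e_theta_theta i j h =>
      rw [contraction_mul_site (succ_ne h), mul_assoc, ← map_mul, tau_xi, smul_mul_assoc,
        xi_mul_xi, map_smul, map_one, mul_smul_comm, mul_one]
    case theta_theta_e i j h =>
      rw [(site_commute (succ_ne h) _ _).eq, mul_assoc, site_mul_contraction (succ_ne h),
        ← mul_assoc, ← map_mul, tau_xi, mul_smul_comm, xi_mul_xi, map_smul, map_one,
        smul_mul_assoc, one_mul]
    case e_theta_e i j h =>
      rw [contraction_site_contraction (succ_ne h), trace_xi]
      cases G <;> simp [eps, traceXi]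
    case theta_z i j hi hj =>
      refine M.site_commute_zOp ?_ _
      have := j.2
      rw [ne_eq, Fin.ext_iff] at hj
      rw [Fin.lt_def]
      omega⟩

theorem action_gen {W : Set (ℕ × ℝ)} (hW : M.Satisfies k W) (g : VWGen k) :
    M.action hW (VWAlgebra.gen g) = M.genOp k g := by
  refine (RingQuot.liftAlgHom_mkAlgHom_apply _ _ _ _).trans ?_
  rw [FreeAlgebra.lift_ι_apply]

variable (k) in
/-- The diagonal action of `K` on `X ⊗ V^{⊗k}`. -/
noncomputable def tensorGrp (κ : G.K) : Module.End ℂ (G.TensorSpace k X) :=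
  TensorProduct.map (M.grp κ) (PiTensorProduct.map fun _ => Matrix.toLin' (G.cmat κ))

theorem tensorGrp_tmul (κ : G.K) (x : X) (v : Fin k → G.StdMod) :
    M.tensorGrp k κ (x ⊗ₜ PiTensorProduct.tprod ℂ v) =
      M.grp κ x ⊗ₜ PiTensorProduct.tprod ℂ (fun i => G.cmat κ *ᵥ v i) := by
  rw [tensorGrp, TensorProduct.map_tmul, PiTensorProduct.map_tprod]
  simp

theorem tensorGrp_mul_site (κ : G.K) (i : Fin k) (A : Matrix G.Idx G.Idx ℂ) :
    M.tensorGrp k κ * site G k X i A =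
      site G k X i (G.cmat κ * A * G.cmat κ⁻¹) * M.tensorGrp k κ := by
  refine tensorSpace_ext fun x v => ?_
  rw [Module.End.mul_apply, Module.End.mul_apply, tensorGrp_tmul, site_tmul, site_tmul,
    tensorGrp_tmul]
  congr 2
  ext1 j
  by_cases h : j = i
  · subst h
    simp [Matrix.mul_assoc, cmat_inv_mul]
  · simp [h]

theorem tensorGrp_mul_factor (κ : G.K) (s : Option (Fin k)) (x : G.lieAlg) :
    M.tensorGrp k κ * M.factor k s x = M.factor k s (G.Ad κ x) * M.tensorGrp k κ := by
  cases s with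
  | none =>
    refine tensorSpace_ext fun y v => ?_
    rw [Module.End.mul_apply, Module.End.mul_apply, tensorGrp_tmul, factor_none_tmul,
      factor_none_tmul, tensorGrp_tmul, M.grp_lie]
  | some i => exact M.tensorGrp_mul_site κ i _

theorem tensorGrp_mul_perm (κ : G.K) (σ : Equiv.Perm (Fin k)) :
    M.tensorGrp k κ * perm G k X σ = perm G k X σ * M.tensorGrp k κ := by
  refine tensorSpace_ext fun x v => ?_
  rw [Module.End.mul_apply, Module.End.mul_apply, tensorGrp_tmul, perm_tmul, perm_tmul,
    tensorGrp_tmul]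

theorem casimirSum_conj {R : Type*} [Ring R] [Algebra ℂ R] (f g : Matrix G.Idx G.Idx ℂ →ₗ[ℂ] R)
    (κ : G.K) :
    ∑ a, ∑ b, f (G.cmat κ * Matrix.single a b 1 * G.cmat κ⁻¹) *
      g (G.cmat κ * Matrix.single b a 1 * G.cmat κ⁻¹) = casimirSum f g := by
  have h := casimirSum_mul_mul f
    (g ∘ₗ LinearMap.mulLeft ℂ (G.cmat κ) ∘ₗ LinearMap.mulRight ℂ (G.cmat κ⁻¹))
    (G.cmat κ) (G.cmat κ⁻¹)
  simp only [LinearMap.comp_apply, LinearMap.mulLeft_apply, LinearMap.mulRight_apply] at h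
  rw [casimirSum]
  simp only [Matrix.mul_assoc] at h ⊢
  rw [h]
  refine Finset.sum_congr rfl fun a _ => Finset.sum_congr rfl fun b _ => ?_
  rw [cmat_mul_inv, Matrix.mul_one, ← Matrix.mul_assoc, cmat_mul_inv, Matrix.one_mul]

theorem tensorGrp_commute_contraction (κ : G.K) (i j : Fin k) :
    Commute (M.tensorGrp k κ) (contraction G k X i j) := by
  rw [Commute, SemiconjBy, contraction, mul_smul_comm, smul_mul_assoc]
  congr 1
  conv_rhs => rw [← casimirSum_conj _ _ κ]
  simp only [casimirSum, Finset.mul_sum, Finset.sum_mul, AlgHom.toLinearMap_apply,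
    LinearMap.comp_apply]
  refine Finset.sum_congr rfl fun a _ => Finset.sum_congr rfl fun b _ => ?_
  rw [← mul_assoc, tensorGrp_mul_site, mul_assoc, tensorGrp_mul_site, mul_assoc, tau_mul, tau_mul,
    tau_cmat, tau_cmat, inv_inv]
  simp only [mul_assoc]

theorem tensorGrp_commute_omega (κ : G.K) (s : Option (Fin k)) (j : Fin k) :
    Commute (M.tensorGrp k κ) (M.omega k s j) := by
  rw [Commute, SemiconjBy, omega]
  conv_rhs => rw [← casimirSum_conj _ _ κ]
  simp only [casimirSum, Finset.mul_sum, Finset.sum_mul, AlgHom.toLinearMap_apply,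
    LinearMap.comp_apply]
  refine Finset.sum_congr rfl fun a _ => Finset.sum_congr rfl fun b _ => ?_
  rw [← mul_assoc, tensorGrp_mul_factor, mul_assoc, tensorGrp_mul_site, Ad_skew]
  simp only [mul_assoc]

theorem tensorGrp_commute_genOp (κ : G.K) (g : VWGen k) :
    Commute (M.tensorGrp k κ) (M.genOp k g) := by
  cases g with
  | t i j h => exact Commute.smul_right (M.tensorGrp_mul_perm κ _) _
  | e i j h => exact M.tensorGrp_commute_contraction κ i j
  | z i => exact M.commute_zOp _ (Commute.sum_right _ _ _ fun s _ => M.tensorGrp_commute_omega κ s i)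
  | theta i =>
    change _ * _ = _ * _
    rw [genOp, tensorGrp_mul_site, cmat_comm_xi, Matrix.mul_assoc, cmat_mul_inv, Matrix.mul_one]

/-- The action of `𝔅_k^θ` on `X ⊗ V^{⊗k}` commutes with the action of `K`. -/
theorem tensorGrp_commute_action {W : Set (ℕ × ℝ)} (hW : M.Satisfies k W) (κ : G.K)
    (b : G.VW k W) : Commute (M.tensorGrp k κ) (M.action hW b) := by
  obtain ⟨a, rfl⟩ := RingQuot.mkAlgHom_surjective ℂ _ b
  induction a using FreeAlgebra.induction with
  | grade0 r => rw [AlgHom.commutes, AlgHom.commutes]; exact (Algebra.commutes r _).symm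
  | grade1 g =>
    have h := M.tensorGrp_commute_genOp κ g
    rw [← M.action_gen hW] at h
    exact h
  | mul a b ha hb => rw [map_mul, map_mul]; exact ha.mul_right hb
  | add a b ha hb => rw [map_add, map_add]; exact ha.add_right hb

variable (k)

/-- `F_{μ,k}(X) = Hom_K(μ, X ⊗ V^{⊗k})` for a character `μ` of `K`, realised on `ℂ`. -/
noncomputable def functorObj (μ : G.K →* ℂˣ) : Submodule ℂ (ℂ →ₗ[ℂ] G.TensorSpace k X) where
  carrier := {φ | ∀ (κ : G.K) (c : ℂ), φ ((μ κ : ℂ) * c) = M.tensorGrp k κ (φ c)}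
  add_mem' := by
    intro φ ψ hφ hψ κ c
    rw [LinearMap.add_apply, LinearMap.add_apply, map_add, hφ κ c, hψ κ c]
  zero_mem' := by intro κ c; simp
  smul_mem' := by
    intro a φ hφ κ c
    rw [LinearMap.smul_apply, LinearMap.smul_apply, map_smul, hφ κ c]

variable {k}

/-- The action of `𝔅_k^θ` on `F_{μ,k}(X)`, inherited from the action on `X ⊗ V^{⊗k}`. -/
noncomputable def functorAction {W : Set (ℕ × ℝ)} (hW : M.Satisfies k W) (μ : G.K →* ℂˣ) :
    G.VW k W →ₐ[ℂ] Module.End ℂ (M.functorObj k μ) :=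
  AlgHom.ofLinearMap
    { toFun := fun b =>
        { toFun := fun φ => ⟨M.action hW b ∘ₗ φ.1, fun κ c => by
            rw [LinearMap.comp_apply, LinearMap.comp_apply, φ.2 κ c]
            exact (LinearMap.congr_fun (M.tensorGrp_commute_action hW κ b).eq (φ.1 c)).symm⟩
          map_add' := fun φ ψ => Subtype.ext (LinearMap.comp_add _ _ _)
          map_smul' := fun a φ => Subtype.ext (LinearMap.comp_smul _ _ _) }
      map_add' := fun b b' => by
        ext1 φ; apply Subtype.ext; ext1; simp
      map_smul' := fun a b => by
        ext1 φ; apply Subtype.ext; ext1; simp }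
    (by ext1 φ; apply Subtype.ext; ext1; simp)
    (fun b b' => by ext1 φ; apply Subtype.ext; ext1; simp)

theorem functorAction_apply {W : Set (ℕ × ℝ)} (hW : M.Satisfies k W) (μ : G.K →* ℂˣ)
    (b : G.VW k W) (φ : M.functorObj k μ) (c : ℂ) :
    (M.functorAction hW μ b φ).1 c = M.action hW b (φ.1 c) := rfl

end GKModule

/-- Sesquilinear forms: linear in the first and conjugate linear in the second variable. -/
abbrev SesqForm (Y : Type*) [AddCommGroup Y] [Module ℂ Y] : Type _ := Y →ₗ[ℂ] Y →ₗ⋆[ℂ] ℂ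

namespace SesqForm

variable {Y : Type*} [AddCommGroup Y] [Module ℂ Y]

/-- Hermitian forms, that is, conjugate symmetric sesquilinear forms. -/
def IsHermitian (h : SesqForm Y) : Prop := ∀ x y, h x y = conj (h y x)

/-- Positive definite Hermitian forms. -/
def IsPosDef (h : SesqForm Y) : Prop := h.IsHermitian ∧ ∀ x, x ≠ 0 → 0 < (h x x).re

/-- Non-degeneracy: the radical is zero. -/
def IsNondegenerate (h : SesqForm Y) : Prop := ∀ x, (∀ y, h x y = 0) → x = 0

end SesqForm

/-- The complex vector space conjugate to `W`. -/
def ConjMod (W : Type*) : Type _ := W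

namespace ConjMod

variable {W : Type*} [AddCommGroup W]

instance : AddCommGroup (ConjMod W) := inferInstanceAs (AddCommGroup W)

noncomputable instance [Module ℂ W] : Module ℂ (ConjMod W) :=
  Module.compHom W (starRingEnd ℂ)

/-- The identity map from the conjugate space to the space. -/
def out (w : ConjMod W) : W := w

end ConjMod

section InducedForm

variable {V : Type*} [AddCommGroup V] [Module ℂ V] {k : ℕ}

/-- For `v' ∈ V^k`, the linear functional `v_1 ⊗ ⋯ ⊗ v_k ↦ ∏ ⟨v_i, v'_i⟩` on `V^{⊗k}`. -/
noncomputable def powFunctional (h : SesqForm V) (v' : Fin k → V) :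
    (⨂[ℂ] _ : Fin k, V) →ₗ[ℂ] ℂ :=
  PiTensorProduct.lift
    ((MultilinearMap.mkPiAlgebra ℂ (Fin k) ℂ).compLinearMap fun i => h.flip (v' i))

theorem powFunctional_tprod (h : SesqForm V) (v v' : Fin k → V) :
    powFunctional h v' (PiTensorProduct.tprod ℂ v) = ∏ i, h (v i) (v' i) := by
  simp [powFunctional]

/-- The form on `V^{⊗k}`, as a linear map to a conjugate space. -/
noncomputable def powFormAux (k : ℕ) (h : SesqForm V) :
    (⨂[ℂ] _ : Fin k, V) →ₗ[ℂ] ConjMod ((⨂[ℂ] _ : Fin k, V) →ₗ[ℂ] ℂ) :=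
  PiTensorProduct.lift
    { toFun := fun v' => powFunctional h v'
      map_update_add' := by
        intro _ v' i x y
        refine PiTensorProduct.ext (MultilinearMap.ext fun v => ?_)
        change powFunctional h _ (PiTensorProduct.tprod ℂ v) =
          powFunctional h _ (PiTensorProduct.tprod ℂ v) +
          powFunctional h _ (PiTensorProduct.tprod ℂ v)
        simp only [powFunctional_tprod]
        rw [← Finset.mul_prod_erase _ _ (Finset.mem_univ i),
          ← Finset.mul_prod_erase _ _ (Finset.mem_univ i),
          ← Finset.mul_prod_erase _ _ (Finset.mem_univ i)]
        simp only [Function.update_self, map_add, add_mul]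
        congr 1 <;> congr 1 <;>
        · refine Finset.prod_congr rfl fun j hj => ?_
          rw [Function.update_of_ne (Finset.ne_of_mem_erase hj),
            Function.update_of_ne (Finset.ne_of_mem_erase hj)]
      map_update_smul' := by
        intro _ v' i c x
        refine PiTensorProduct.ext (MultilinearMap.ext fun v => ?_)
        change powFunctional h _ (PiTensorProduct.tprod ℂ v) =
          (starRingEnd ℂ c) * powFunctional h _ (PiTensorProduct.tprod ℂ v)
        simp only [powFunctional_tprod]
        rw [← Finset.mul_prod_erase _ _ (Finset.mem_univ i),
          ← Finset.mul_prod_erase _ _ (Finset.mem_univ i)]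
        simp only [Function.update_self, LinearMap.map_smulₛₗ, smul_eq_mul, mul_assoc]
        congr 2
        refine Finset.prod_congr rfl fun j hj => ?_
        rw [Function.update_of_ne (Finset.ne_of_mem_erase hj),
          Function.update_of_ne (Finset.ne_of_mem_erase hj)] }

/-- The form on `V^{⊗k}` with `⟨v_1 ⊗ ⋯ ⊗ v_k, v'_1 ⊗ ⋯ ⊗ v'_k⟩ = ∏ ⟨v_i, v'_i⟩`. -/
noncomputable def powForm (k : ℕ) (h : SesqForm V) : SesqForm (⨂[ℂ] _ : Fin k, V) :=
  LinearMap.flip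
    { toFun := fun w => (powFormAux k h w).out
      map_add' := fun w w' => (powFormAux k h).map_add w w'
      map_smul' := fun c w => (powFormAux k h).map_smul c w }

theorem powForm_tprod (h : SesqForm V) (v v' : Fin k → V) :
    powForm k h (PiTensorProduct.tprod ℂ v) (PiTensorProduct.tprod ℂ v') =
      ∏ i, h (v i) (v' i) := by
  change (powFormAux k h (PiTensorProduct.tprod ℂ v')).out (PiTensorProduct.tprod ℂ v) = _
  rw [powFormAux, PiTensorProduct.lift.tprod]
  exact powFunctional_tprod h v v'

variable {X : Type*} [AddCommGroup X] [Module ℂ X]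

/-- The form on `X ⊗ V^{⊗k}` induced by forms on `X` and on `V`. -/
noncomputable def tensorForm (k : ℕ) (hX : SesqForm X) (hV : SesqForm V) :
    SesqForm (X ⊗[ℂ] (⨂[ℂ] _ : Fin k, V)) :=
  ((TensorProduct.dualDistrib ℂ X (⨂[ℂ] _ : Fin k, V)) ∘ₛₗ
    (TensorProduct.map hX.flip (powForm k hV).flip)).flip

theorem tensorForm_tmul (hX : SesqForm X) (hV : SesqForm V) (x x' : X) (v v' : Fin k → V) :
    tensorForm k hX hV (x ⊗ₜ PiTensorProduct.tprod ℂ v) (x' ⊗ₜ PiTensorProduct.tprod ℂ v') =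
      hX x x' * ∏ i, hV (v i) (v' i) := by
  rw [← powForm_tprod]
  rfl

end InducedForm

namespace ClassicalGroup

/-- The condition on a form on `V` to be used in the construction of the induced forms: it is
non-degenerate, and `K` acts by unitary and `𝔭₀` by self-adjoint operators. -/
def IsCompatible (G : ClassicalGroup) (hV : SesqForm G.StdMod) : Prop :=
  hV.IsNondegenerate ∧
  (∀ (κ : G.K) (v w : G.StdMod), hV (G.cmat κ *ᵥ v) w = hV v (G.cmat κ⁻¹ *ᵥ w)) ∧
  ∀ (P : Matrix G.Idx G.Idx ℝ), G.IsNoncompactReal P → ∀ v w : G.StdMod,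
    hV (P.map Complex.ofRealHom *ᵥ v) w = hV v (P.map Complex.ofRealHom *ᵥ w)

end ClassicalGroup

namespace GKModule
open ClassicalGroup

variable {G : ClassicalGroup} {X : Type*} [AddCommGroup X] [Module ℂ X] (M : GKModule G X) {k : ℕ}

/-- `*`-invariance of a form on a `(𝔤, K)`-module: `⟨g x, y⟩ = ⟨x, g^* y⟩` for `g ∈ 𝔤`. -/
def IsInvariant (hX : SesqForm X) : Prop :=
  ∀ (g : G.lieAlg) (x y : X), hX (M.lie g x) y = hX x (M.lie (G.lieStar g) y)

/-- A `(𝔤, K)`-module is unitary if it has a positive definite invariant Hermitian form. -/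
def IsUnitary : Prop := ∃ hX : SesqForm X, hX.IsPosDef ∧ M.IsInvariant hX

/-- The form `⟨φ, ψ⟩ = ⟨φ(1), ψ(1)⟩` on `F_{μ,k}(X)` induced by forms on `X` and on `V`. -/
noncomputable def functorForm (k : ℕ) (μ : G.K →* ℂˣ) (hX : SesqForm X)
    (hV : SesqForm G.StdMod) : SesqForm (M.functorObj k μ) :=
  ((tensorForm k hX hV).comp (LinearMap.applyₗ (1 : ℂ) ∘ₗ (M.functorObj k μ).subtype)).compl₂
    (LinearMap.applyₗ (1 : ℂ) ∘ₗ (M.functorObj k μ).subtype)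

theorem functorForm_apply (μ : G.K →* ℂˣ) (hX : SesqForm X) (hV : SesqForm G.StdMod)
    (φ ψ : M.functorObj k μ) :
    M.functorForm k μ hX hV φ ψ = tensorForm k hX hV (φ.1 1) (ψ.1 1) := rfl

/-- `*`-invariance of a form on `F_{μ,k}(X)`: `⟨b φ, ψ⟩ = ⟨φ, b^* ψ⟩` for `b ∈ 𝔅_k^θ`. -/
def IsFunctorInvariant {W : Set (ℕ × ℝ)} (hW : M.Satisfies k W) (μ : G.K →* ℂˣ)
    (h : SesqForm (M.functorObj k μ)) : Prop :=
  ∀ (b : G.VW k W) (φ ψ : M.functorObj k μ),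
    h (M.functorAction hW μ b φ) ψ = h φ (M.functorAction hW μ (VWAlgebra.starOp b) ψ)

/-- The `𝔅_k^θ`-module `F_{μ,k}(X)` is unitary: it has a positive definite invariant Hermitian
form. -/
def IsFunctorUnitary {W : Set (ℕ × ℝ)} (hW : M.Satisfies k W) (μ : G.K →* ℂˣ) : Prop :=
  ∃ h : SesqForm (M.functorObj k μ), h.IsPosDef ∧ M.IsFunctorInvariant hW μ h

end GKModule

/-! The induced form on `F_{μ,k}(X)` is the pullback, along `φ ↦ φ(1)`, of the product form on `X ⊗
V^{⊗k}`, and the algebra acts on `φ` by composition. It is therefore enough to show on `X ⊗ V^{⊗k}`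
that `b^*` acts by an adjoint of `b`. "Adjoint" is a relation between two operators here
(`AdjointPair`), because the form on `X` may be degenerate.

Put `Ξ = ξ ⊗ ⋯ ⊗ ξ` on the copies of `V`; this is how `w₀` acts (`action_w₀`), and `Ξ² = 1`. Taking
adjoints reverses products and conjugates scalars, and so does `b ↦ Ξ b^• Ξ`. Hence only generators
need checking (`adjointPair_action`): each operator `T` of a generator must have adjoint `Ξ T Ξ`
(`adjointPair_genOp`).

The heart is the operator `Ω`. Let `Y` be a real element of `𝔤`. For a compatible form on `V`, the
`𝔨₀`-part of `Y` is skew and the `𝔭₀`-part is self-adjoint, so the adjoint of `Y` is `Yᵀ = -ξ Y ξ`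
(`IsCompatible.real`, `xi_mul_mul_xi`). On `X` the adjoint is `-Y`, which is again `-Ξ Y Ξ` because
`Ξ` does not touch `X`. Since `2Ω` is a sum of products of two commuting factors of this kind
(`two_smul_omega`), the signs cancel and `Ω` has adjoint `Ξ Ω Ξ` (`adjointPair_omega`). This settles
`z_i`. Permutations are isometries commuting with `Ξ`, which settles `t`; then `e = ε(s - Ω)` needs
nothing new. Finally `θ_i` acts by `ξ`, which is self-adjoint because `J` lies in `K`.

For unitarity take the standard Hermitian form on `V`. It is compatible, and it makes `X ⊗ V^{⊗k}`
an orthogonal sum of copies of `X`, so the product form is positive definite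
(`tensorForm_stdForm_isPosDef`); evaluation at `1` is injective on linear maps out of `ℂ`. -/

/-- The cancellation of signs used for `Ω`: each factor contributes one minus sign, and `w * w = 1`
is inserted between the factors. -/
theorem conj_mul_eq_neg_conj_mul_neg_conj {R : Type*} [Ring R] (w a b : R) (hw : w * w = 1) :
    w * (b * a) * w = -(w * b * w) * -(w * a * w) :=
  calc w * (b * a) * w = w * b * 1 * a * w := by noncomm_ring
    _ = _ := by rw [← hw]; noncomm_ring

/-- Solves `Ω = s - ε e` for the contraction `e`. The coefficient `-1` is written as the cast of a
real number so that `AdjointPair.real_smul` applies to it. -/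
theorem eq_smul_add_neg_smul_sub {R : Type*} [AddCommGroup R] [Module ℂ R] {c : ℂ}
    (hc : c * c = 1) (p e : R) : e = c • (p + ((-1 : ℝ) : ℂ) • (p - c • e)) := by
  rw [Complex.ofReal_neg, Complex.ofReal_one, neg_one_smul, neg_sub, add_sub_cancel, smul_smul,
    hc, one_smul]

/-! ### Calculus of adjoint pairs of operators -/

namespace SesqForm

variable {Y : Type*} [AddCommGroup Y] [Module ℂ Y]

/-- `B` is adjoint to `A` with respect to the form `h`. -/
def AdjointPair (h : SesqForm Y) (A B : Module.End ℂ Y) : Prop := ∀ u w, h (A u) w = h u (B w)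

namespace AdjointPair

variable {h : SesqForm Y} {A A' B B' : Module.End ℂ Y}

theorem one : h.AdjointPair 1 1 := fun _ _ => rfl

theorem mul (hA : h.AdjointPair A A') (hB : h.AdjointPair B B') :
    h.AdjointPair (A * B) (B' * A') := fun u w => by
  rw [Module.End.mul_apply, Module.End.mul_apply, hA, hB]

theorem add (hA : h.AdjointPair A A') (hB : h.AdjointPair B B') :
    h.AdjointPair (A + B) (A' + B') := fun u w => by
  rw [LinearMap.add_apply, LinearMap.add_apply, map_add, map_add, LinearMap.add_apply, hA, hB]

theorem smul (c : ℂ) (hA : h.AdjointPair A A') :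
    h.AdjointPair (c • A) (conj c • A') := fun u w => by
  rw [LinearMap.smul_apply, LinearMap.smul_apply, map_smul, LinearMap.map_smulₛₗ,
    LinearMap.smul_apply, hA, starRingEnd_self_apply]

/-- The scalars in the operators of the generators (`ε`, `(N - ε)/2`) and the factor `1/2` that
recovers `Ω` from `2Ω` are real, so conjugation does not affect them. -/
theorem real_smul (r : ℝ) (hA : h.AdjointPair A A') :
    h.AdjointPair ((r : ℂ) • A) ((r : ℂ) • A') := by
  simpa using hA.smul (r : ℂ)

theorem sum {ι : Type*} (s : Finset ι) {f g : ι → Module.End ℂ Y}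
    (hfg : ∀ i ∈ s, h.AdjointPair (f i) (g i)) :
    h.AdjointPair (∑ i ∈ s, f i) (∑ i ∈ s, g i) := fun u w => by
  simp only [LinearMap.sum_apply, map_sum]
  exact Finset.sum_congr rfl fun i hi => hfg i hi u w

end AdjointPair

end SesqForm

/-! ### The product form and adjoints of operators on the tensor factors -/

namespace ClassicalGroup

variable {G : ClassicalGroup} {k : ℕ} {X : Type*} [AddCommGroup X] [Module ℂ X]

/-- No case for scalars is required: a scalar multiple of a pure tensor in `V^{⊗k}` can be absorbed
into the vector of `X`. -/
theorem tensorSpace_induction {p : G.TensorSpace k X → Prop}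
    (tmul : ∀ x v, p (x ⊗ₜ PiTensorProduct.tprod ℂ v))
    (add : ∀ u w, p u → p w → p (u + w)) (u : G.TensorSpace k X) : p u := by
  induction u using TensorProduct.induction_on with
  | zero => simpa using tmul 0 0
  | add u w hu hw => exact add u w hu hw
  | tmul x t =>
    induction t using PiTensorProduct.induction_on generalizing x with
    | smul_tprod r v => rw [← TensorProduct.smul_tmul]; exact tmul _ _
    | add s t hs ht => rw [TensorProduct.tmul_add]; exact add _ _ (hs x) (ht x)

theorem adjointPair_of_tmul {h : SesqForm (G.TensorSpace k X)}
    {A B : Module.End ℂ (G.TensorSpace k X)}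
    (hAB : ∀ x v x' v', h (A (x ⊗ₜ PiTensorProduct.tprod ℂ v)) (x' ⊗ₜ PiTensorProduct.tprod ℂ v') =
      h (x ⊗ₜ PiTensorProduct.tprod ℂ v) (B (x' ⊗ₜ PiTensorProduct.tprod ℂ v'))) :
    h.AdjointPair A B := by
  intro u w
  induction u using tensorSpace_induction with
  | add u u' hu hu' => simp only [map_add, LinearMap.add_apply, hu, hu']
  | tmul x v =>
    induction w using tensorSpace_induction with
    | add w w' hw hw' => simp only [map_add, hw, hw']
    | tmul x' v' => exact hAB x v x' v'

theorem tensorForm_isHermitian {hX : SesqForm X} {hV : SesqForm G.StdMod} (h : hX.IsHermitian)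
    (h' : hV.IsHermitian) : (tensorForm k hX hV).IsHermitian := by
  intro u w
  induction u using tensorSpace_induction with
  | add u u' hu hu' => simp only [map_add, LinearMap.add_apply, hu, hu']
  | tmul x v =>
    induction w using tensorSpace_induction with
    | add w w' hw hw' => simp only [map_add, LinearMap.add_apply, hw, hw']
    | tmul x' v' =>
      rw [tensorForm_tmul, tensorForm_tmul, map_mul, map_prod, ← h]
      congr 1
      exact Finset.prod_congr rfl fun i _ => h' _ _

theorem adjointPair_site (hX : SesqForm X) {hV : SesqForm G.StdMod} {A B : Matrix G.Idx G.Idx ℂ}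
    (h : ∀ v w, hV (A *ᵥ v) w = hV v (B *ᵥ w)) (i : Fin k) :
    (tensorForm k hX hV).AdjointPair (site G k X i A) (site G k X i B) := by
  refine adjointPair_of_tmul fun x v x' v' => ?_
  rw [site_tmul, site_tmul, tensorForm_tmul, tensorForm_tmul]
  congr 1
  refine Finset.prod_congr rfl fun j _ => ?_
  by_cases hj : j = i
  · subst hj; simpa using h _ _
  · simp [hj]

/-- A permutation of the factors only reindexes the product `∏ ⟨v_i, v'_i⟩`, so it is an isometry
whatever the form on `V`. -/
theorem adjointPair_perm (hX : SesqForm X) (hV : SesqForm G.StdMod) (σ : Equiv.Perm (Fin k)) :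
    (tensorForm k hX hV).AdjointPair (perm G k X σ) (perm G k X σ⁻¹) := by
  refine adjointPair_of_tmul fun x v x' v' => ?_
  rw [perm_tmul, perm_tmul, tensorForm_tmul, tensorForm_tmul]
  congr 1
  exact Fintype.prod_equiv σ.symm _ _ fun i => by simp [Equiv.Perm.inv_def]

/-! ### The operator of the longest element -/

variable (G k X) in
/-- The action of `ξ ⊗ ⋯ ⊗ ξ` on `X ⊗ V^{⊗k}`. -/
noncomputable def xiAll : Module.End ℂ (G.TensorSpace k X) :=
  LinearMap.lTensor X (PiTensorProduct.map fun _ => Matrix.toLin' G.xi)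

theorem xiAll_tmul (x : X) (v : Fin k → G.StdMod) :
    xiAll G k X (x ⊗ₜ PiTensorProduct.tprod ℂ v) =
      x ⊗ₜ PiTensorProduct.tprod ℂ (fun i => G.xi *ᵥ v i) := by
  rw [xiAll, LinearMap.lTensor_tmul, PiTensorProduct.map_tprod]
  simp

theorem xiAll_mul_self : xiAll G k X * xiAll G k X = 1 := by
  refine tensorSpace_ext fun x v => ?_
  rw [Module.End.mul_apply, xiAll_tmul, xiAll_tmul]
  simp [xi_mul_xi]

theorem xiAll_mul_perm (σ : Equiv.Perm (Fin k)) :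
    xiAll G k X * perm G k X σ = perm G k X σ * xiAll G k X := by
  refine tensorSpace_ext fun x v => ?_
  rw [Module.End.mul_apply, Module.End.mul_apply, perm_tmul, xiAll_tmul, xiAll_tmul, perm_tmul]

/-- Conjugation by `ξ ⊗ ⋯ ⊗ ξ` is the Cartan involution at each site: the copies of `ξ` at the other
sites cancel in pairs. -/
theorem xiAll_mul_site (i : Fin k) (A : Matrix G.Idx G.Idx ℂ) :
    xiAll G k X * site G k X i A = site G k X i (G.xi * A * G.xi) * xiAll G k X := by
  refine tensorSpace_ext fun x v => ?_
  rw [Module.End.mul_apply, Module.End.mul_apply, xiAll_tmul, site_tmul, site_tmul, xiAll_tmul]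
  congr 2
  ext1 j
  by_cases h : j = i
  · subst h; simp [Matrix.mul_assoc, xi_mul_xi]
  · simp [h]

/-- A version of `prod_site_xi` for partial products, suited to induction. Absence of repetitions
matters because a second `ξ` at the same site would cancel the first. -/
theorem prod_site_xi_tmul (l : List (Fin k)) (hl : l.Nodup) (x : X) (v : Fin k → G.StdMod) :
    (l.map fun i => site G k X i G.xi).prod (x ⊗ₜ PiTensorProduct.tprod ℂ v) =
      x ⊗ₜ PiTensorProduct.tprod ℂ (fun i => if i ∈ l then G.xi *ᵥ v i else v i) := by
  induction l with
  | nil => simp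
  | cons a l ih =>
    rw [List.map_cons, List.prod_cons, Module.End.mul_apply, ih hl.of_cons, site_tmul]
    congr 2
    ext1 j
    by_cases h : j = a
    · subst h; simp [(List.nodup_cons.1 hl).1]
    · simp [h]

theorem prod_site_xi :
    (List.ofFn fun i : Fin k => site G k X i G.xi).prod = xiAll G k X := by
  refine tensorSpace_ext fun x v => ?_
  rw [List.ofFn_eq_map, prod_site_xi_tmul _ (List.nodup_finRange k), xiAll_tmul]
  simp

/-! ### Real elements of the Lie algebra -/

/-- The transpose of a real matrix in `𝔤` is given by the Cartan involution. -/
theorem xi_mul_mul_xi {x : Matrix G.Idx G.Idx ℂ} (hx : x ∈ G.lieAlg) :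
    G.xi * x * G.xi = -xᵀ := by
  -- Conjugation by `ξ` is conjugation by `J` in both cases. For `Sp` the two factors `i` give `-1`,
  -- which is the sign in `Jᵀ = -J`.
  have h : G.xi * x * G.xi = G.Jc * x * G.Jcᵀ := by
    cases G with
    | O p q n h => rw [Jc_transpose]; simp [xi, eps]
    | Sp n => rw [Jc_transpose]; simp [xi, eps, smul_smul]
  rw [h, eq_neg_of_add_eq_zero_right ((G.mem_lieAlg x).1 hx), Matrix.neg_mul, Matrix.mul_assoc,
    Jc_mul_Jc_transpose, Matrix.mul_one]

/-- Since `J` is real, the projection of a matrix unit to `𝔤` has real entries. This makes the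
elements occurring in `Ω` accessible to the hypotheses on `K` and `𝔭₀`, which only concern real
matrices. -/
theorem exists_real_skew_single (a b : G.Idx) : ∃ Y : Matrix G.Idx G.Idx ℝ,
    Yᵀ * G.J + G.J * Y = 0 ∧
      (G.skew (Matrix.single a b 1) : Matrix G.Idx G.Idx ℂ) = Y.map Complex.ofRealHom := by
  have h : (G.skew (Matrix.single a b 1) : Matrix G.Idx G.Idx ℂ) =
      (Matrix.single a b 1 - G.Jᵀ * (Matrix.single a b 1)ᵀ * G.J).map Complex.ofRealHom := by
    have h1 : (Matrix.single a b (1 : ℝ)).map Complex.ofRealHom = Matrix.single a b 1 := by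
      simp
    rw [Matrix.map_sub _ (map_sub Complex.ofRealHom), Matrix.map_mul, Matrix.map_mul, h1,
      Matrix.transpose_map, Matrix.transpose_map, h1]
    rfl
  refine ⟨_, ?_, h⟩
  have h2 := (G.mem_lieAlg _).1 (G.skew (Matrix.single a b 1)).2
  rw [h, Jc, ← Matrix.transpose_map, ← Matrix.map_mul, ← Matrix.map_mul,
    ← Matrix.map_add _ (map_add Complex.ofRealHom)] at h2
  refine Matrix.map_injective Complex.ofReal_injective (h2.trans ?_)
  ext; simp

theorem lieStar_skew_single (a b : G.Idx) :
    G.lieStar (G.skew (Matrix.single a b 1)) = -G.skew (Matrix.single a b 1) := by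
  obtain ⟨Y, -, hY⟩ := exists_real_skew_single a b
  ext1
  change -(G.skew (Matrix.single a b 1) : Matrix G.Idx G.Idx ℂ).map conj =
    -(G.skew (Matrix.single a b 1) : Matrix G.Idx G.Idx ℂ)
  rw [hY]
  ext; simp

/-! ### Adjoints on the defining module for a compatible form -/

section Compatible

variable {hV : SesqForm G.StdMod}

/-- Differentiate `⟨exp(tY) v, w⟩ = ⟨v, exp(-tY) w⟩` at `t = 0`. Both sides are real-linear
functions of the exponential on a finite-dimensional matrix space, hence continuous. -/
theorem IsCompatible.compact (h : G.IsCompatible hV) {Y : Matrix G.Idx G.Idx ℝ}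
    (hY : G.IsCompactReal Y) (v w : G.StdMod) :
    hV (Y.map Complex.ofRealHom *ᵥ v) w = -hV v (Y.map Complex.ofRealHom *ᵥ w) := by
  let L : Matrix G.Idx G.Idx ℝ →ₗ[ℝ] ℂ :=
    { toFun := fun A => hV (A.map Complex.ofRealHom *ᵥ v) w
      map_add' := fun A B => by
        rw [Matrix.map_add _ (map_add Complex.ofRealHom), Matrix.add_mulVec, map_add,
          LinearMap.add_apply]
      map_smul' := fun c A => by
        have : (c • A).map Complex.ofRealHom = (c : ℂ) • A.map Complex.ofRealHom := by ext; simp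
        rw [this, Matrix.smul_mulVec, map_smul, LinearMap.smul_apply]; rfl }
  -- Conjugate linearity in the second variable becomes linearity over `ℝ`.
  let R : Matrix G.Idx G.Idx ℝ →ₗ[ℝ] ℂ :=
    { toFun := fun A => hV v (A.map Complex.ofRealHom *ᵥ w)
      map_add' := fun A B => by
        rw [Matrix.map_add _ (map_add Complex.ofRealHom), Matrix.add_mulVec, map_add]
      map_smul' := fun c A => by
        have : (c • A).map Complex.ofRealHom = (c : ℂ) • A.map Complex.ofRealHom := by ext; simp
        rw [this, Matrix.smul_mulVec, LinearMap.map_smulₛₗ, Complex.conj_ofReal]; rfl }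
  -- An auxiliary norm, introduced only to differentiate the matrix exponential.
  let _ : NormedRing (Matrix G.Idx G.Idx ℝ) := Matrix.linftyOpNormedRing
  let _ : NormedAlgebra ℝ (Matrix G.Idx G.Idx ℝ) := Matrix.linftyOpNormedAlgebra
  have hd : ∀ Z : Matrix G.Idx G.Idx ℝ,
      HasDerivAt (fun t : ℝ => NormedSpace.exp (t • Z)) Z 0 := by
    intro Z
    have h := hasDerivAt_exp_smul_const (𝕂 := ℝ) Z (0 : ℝ)
    rw [zero_smul, NormedSpace.exp_zero, one_mul] at h
    exact h
  have h1 : HasDerivAt (fun t : ℝ => L (NormedSpace.exp (t • Y))) (L Y) 0 :=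
    L.toContinuousLinearMap.hasFDerivAt.comp_hasDerivAt (0 : ℝ) (hd Y)
  have h2 : HasDerivAt (fun t : ℝ => R (NormedSpace.exp (t • -Y))) (R (-Y)) 0 :=
    R.toContinuousLinearMap.hasFDerivAt.comp_hasDerivAt (0 : ℝ) (hd (-Y))
  have h3 : (fun t : ℝ => L (NormedSpace.exp (t • Y))) =
      fun t : ℝ => R (NormedSpace.exp (t • -Y)) := by
    ext1 t
    rw [smul_neg]
    -- The inverse stored in `expK` is `exp(-(tY))` by construction, so unitarity of `K` is
    -- literally the required equality.
    exact h.2.1 (G.expK Y hY t) v w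
  rw [h3] at h1
  have h4 : L Y = R (-Y) := h1.unique h2
  rw [map_neg] at h4
  exact h4

/-- Split `Y` by the Cartan decomposition into `(Y - Yᵀ)/2` in `𝔨₀` and `(Y + Yᵀ)/2` in `𝔭₀`. The
first is skew and the second self-adjoint for the form, so passing to the adjoint has the same
effect as transposing. -/
theorem IsCompatible.real (h : G.IsCompatible hV) {Y : Matrix G.Idx G.Idx ℝ}
    (hY : Yᵀ * G.J + G.J * Y = 0) (v w : G.StdMod) :
    hV (Y.map Complex.ofRealHom *ᵥ v) w = hV v (Yᵀ.map Complex.ofRealHom *ᵥ w) := by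
  -- The real Lie algebra is stable under transposition: multiply its defining equation by `J` on
  -- the left and by `Jᵀ` on the right. This puts both halves of the decomposition in `𝔤₀`.
  have hY' : Y * G.J + G.J * Yᵀ = 0 := by
    have h1 : G.J * G.Jᵀ = 1 := mul_eq_one_comm.1 G.J_transpose_mul_J
    have h2 : G.J * G.J = G.eps • (1 : Matrix G.Idx G.Idx ℝ) := by
      rw [← h1, J_transpose, Matrix.mul_smul, smul_smul, eps_mul_eps, one_smul]
    have h3 : G.J * (Yᵀ * G.J + G.J * Y) * G.Jᵀ = Y * G.J + G.J * Yᵀ := by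
      calc _ = (G.J * G.J) * Y * G.Jᵀ + G.J * Yᵀ * (G.J * G.Jᵀ) := by noncomm_ring
        _ = _ := by rw [h1, h2, J_transpose]; simp [smul_smul, eps_mul_eps]
    rw [← h3, hY, Matrix.mul_zero, Matrix.zero_mul]
  have hc : G.IsCompactReal ((1 / 2 : ℝ) • (Y - Yᵀ)) := by
    refine ⟨?_, by rw [Matrix.transpose_smul, Matrix.transpose_sub, Matrix.transpose_transpose,
      ← smul_neg, neg_sub]⟩
    rw [Matrix.transpose_smul, Matrix.transpose_sub, Matrix.transpose_transpose, Matrix.smul_mul,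
      Matrix.mul_smul, ← smul_add, Matrix.sub_mul, Matrix.mul_sub, sub_add_sub_comm, hY, hY',
      sub_zero, smul_zero]
  have hn : G.IsNoncompactReal ((1 / 2 : ℝ) • (Y + Yᵀ)) := by
    refine ⟨?_, by rw [Matrix.transpose_smul, Matrix.transpose_add, Matrix.transpose_transpose,
      add_comm]⟩
    rw [Matrix.transpose_smul, Matrix.transpose_add, Matrix.transpose_transpose, Matrix.smul_mul,
      Matrix.mul_smul, ← smul_add, Matrix.add_mul, Matrix.mul_add, add_add_add_comm, hY, hY',
      add_zero, smul_zero]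
  have e1 : Y.map Complex.ofRealHom = ((1 / 2 : ℝ) • (Y - Yᵀ)).map Complex.ofRealHom +
      ((1 / 2 : ℝ) • (Y + Yᵀ)).map Complex.ofRealHom := by
    ext; simp; ring
  have e2 : Yᵀ.map Complex.ofRealHom = -((1 / 2 : ℝ) • (Y - Yᵀ)).map Complex.ofRealHom +
      ((1 / 2 : ℝ) • (Y + Yᵀ)).map Complex.ofRealHom := by
    ext; simp; ring
  rw [e1, e2, Matrix.add_mulVec, Matrix.add_mulVec, map_add, map_add, LinearMap.add_apply,
    h.compact hc, h.2.2 _ hn, Matrix.neg_mulVec, map_neg]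

/-- Replaces the transpose in `IsCompatible.real` by conjugation with `ξ`, the shape in which `w₀`
enters the star operation. -/
theorem IsCompatible.skew_single (h : G.IsCompatible hV) (a b : G.Idx) (v w : G.StdMod) :
    hV ((G.skew (Matrix.single a b 1) : Matrix G.Idx G.Idx ℂ) *ᵥ v) w =
      hV v ((-(G.xi * (G.skew (Matrix.single a b 1) : Matrix G.Idx G.Idx ℂ) * G.xi)) *ᵥ w) := by
  obtain ⟨Y, hY, hs⟩ := exists_real_skew_single a b
  rw [xi_mul_mul_xi (G.skew (Matrix.single a b 1)).2, neg_neg, hs, ← Matrix.transpose_map]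
  exact h.real hY v w

/-- The matrix `J` is itself an element of `K`, so it is unitary for the form, with inverse `Jᵀ =
εJ`. -/
theorem IsCompatible.Jc (h : G.IsCompatible hV) (v w : G.StdMod) :
    hV (G.Jc *ᵥ v) w = hV v (((G.eps : ℂ) • G.Jc) *ᵥ w) := by
  let κ : G.K := ⟨⟨G.J, G.Jᵀ, mul_eq_one_comm.1 G.J_transpose_mul_J, G.J_transpose_mul_J⟩, by
    refine ⟨?_, G.J_transpose_mul_J⟩
    change G.Jᵀ * G.J * G.J = G.J
    rw [G.J_transpose_mul_J, Matrix.one_mul]⟩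
  rw [← Jc_transpose]
  exact (h.2.1 κ v w).trans (by rw [← cmat_transpose]; rfl)

/-- For `O(p,q)` the matrix `J` is already self-adjoint. For `Sp` it is skew-adjoint, and the
conjugate of the factor `i` in `ξ = iJ` supplies the missing sign. -/
theorem IsCompatible.xi (h : G.IsCompatible hV) (v w : G.StdMod) :
    hV (G.xi *ᵥ v) w = hV v (G.xi *ᵥ w) := by
  cases G with
  | O p q n hn => simpa [ClassicalGroup.xi, eps] using h.Jc v w
  | Sp n =>
    have h1 := h.Jc v w
    simp only [ClassicalGroup.xi, Matrix.smul_mulVec, map_smul, LinearMap.smul_apply, h1,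
      LinearMap.map_smulₛₗ, eps]
    simp

end Compatible

end ClassicalGroup

/-! ### Adjoints of the generators of the algebra -/

namespace GKModule
open ClassicalGroup

variable {G : ClassicalGroup} {X : Type*} [AddCommGroup X] [Module ℂ X] (M : GKModule G X) {k : ℕ}
  {hX : SesqForm X} {hV : SesqForm G.StdMod}

theorem xiAll_mul_factor_none (x : G.lieAlg) :
    xiAll G k X * M.factor k none x = M.factor k none x * xiAll G k X := by
  refine tensorSpace_ext fun y v => ?_
  rw [Module.End.mul_apply, Module.End.mul_apply, factor_none_tmul, xiAll_tmul, xiAll_tmul,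
    factor_none_tmul]

theorem xiAll_conj_site (i : Fin k) (A : Matrix G.Idx G.Idx ℂ) :
    xiAll G k X * site G k X i A * xiAll G k X = site G k X i (G.xi * A * G.xi) := by
  rw [xiAll_mul_site, mul_assoc, xiAll_mul_self, mul_one]

variable {M} in
-- One formula covers two different reasons. On a copy of `V` the conjugation is the Cartan
-- involution coming from compatibility. On `X` invariance gives just `-Y` for real `Y`, and
-- conjugation by `xiAll` changes nothing there.
theorem IsInvariant.adjointPair_factor (hI : M.IsInvariant hX) (hC : G.IsCompatible hV)
    (s : Option (Fin k)) (a b : G.Idx) :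
    (tensorForm k hX hV).AdjointPair (M.factor k s (G.skew (Matrix.single a b 1)))
      (-(xiAll G k X * M.factor k s (G.skew (Matrix.single a b 1)) * xiAll G k X)) := by
  cases s with
  | none =>
    rw [xiAll_mul_factor_none, mul_assoc, xiAll_mul_self, mul_one, ← map_neg]
    refine adjointPair_of_tmul fun x v x' v' => ?_
    rw [factor_none_tmul, factor_none_tmul, tensorForm_tmul, tensorForm_tmul, hI,
      lieStar_skew_single]
  | some i =>
    rw [factor_some, xiAll_conj_site, ← map_neg]
    exact adjointPair_site hX (hC.skew_single a b) i

/-- In the definition of `Ω` the second leg is a bare matrix unit, which need not lie in `𝔤`, so its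
adjoint is not controlled. Projecting that leg to `𝔤` as well doubles the sum, because applying `τ`
to the second leg changes the sign of the sum. -/
theorem two_smul_omega (s : Option (Fin k)) (j : Fin k) :
    (2 : ℂ) • M.omega k s j = ∑ a, ∑ b, M.factor k s (G.skew (Matrix.single a b 1)) *
      M.factor k (some j) (G.skew (Matrix.single b a 1)) := by
  have h := M.casimirSum_factor_tau s (site G k X j).toLinearMap
  have h2 : ∑ a, ∑ b, M.factor k s (G.skew (Matrix.single a b 1)) *
      M.factor k (some j) (G.skew (Matrix.single b a 1)) =
      casimirSum (M.factor k s ∘ₗ G.skew) (site G k X j).toLinearMap -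
        casimirSum (M.factor k s ∘ₗ G.skew) ((site G k X j).toLinearMap ∘ₗ G.tau) := by
    simp only [casimirSum, ← Finset.sum_sub_distrib, ← mul_sub]
    refine Finset.sum_congr rfl fun a _ => Finset.sum_congr rfl fun b _ => ?_
    rw [factor_some, skew_coe, map_sub]
    rfl
  rw [h2, h, sub_neg_eq_add, ← two_smul ℂ]
  rfl

variable {M} in
-- Each term of `2Ω` is a product of two operators with adjoints `-Ξ Y Ξ`. The two minus signs
-- cancel, and the reversal of order is harmless because the factors `s` and `j` are distinct.
theorem IsInvariant.adjointPair_omega (hI : M.IsInvariant hX) (hC : G.IsCompatible hV)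
    {s : Option (Fin k)} {j : Fin k} (h : s ≠ some j) :
    (tensorForm k hX hV).AdjointPair (M.omega k s j)
      (xiAll G k X * M.omega k s j * xiAll G k X) := by
  have h1 : (tensorForm k hX hV).AdjointPair ((2 : ℂ) • M.omega k s j)
      (xiAll G k X * ((2 : ℂ) • M.omega k s j) * xiAll G k X) := by
    rw [two_smul_omega]
    simp only [Finset.mul_sum, Finset.sum_mul]
    refine .sum _ fun a _ => .sum _ fun b _ => ?_
    convert (hI.adjointPair_factor hC s a b).mul (hI.adjointPair_factor hC (some j) b a) using 1
    -- Exchanges the two factors to match the reversed order in the adjoint of a product.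
    rw [(M.factor_commute_factor h _ _).eq]
    exact conj_mul_eq_neg_conj_mul_neg_conj _ _ _ xiAll_mul_self
  have h2 := h1.real_smul (1 / 2)
  rw [mul_smul_comm, smul_mul_assoc, smul_smul, smul_smul] at h2
  norm_num at h2
  exact h2

variable {M} in
-- All four kinds of generators reduce to permutations, `Ω` and `ξ`. The antihomomorphism `•` fixes
-- generators, so this is the invariance condition for them.
theorem IsInvariant.adjointPair_genOp (hI : M.IsInvariant hX) (hC : G.IsCompatible hV)
    (g : VWGen k) : (tensorForm k hX hV).AdjointPair (M.genOp k g)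
      (xiAll G k X * M.genOp k g * xiAll G k X) := by
  have hperm : ∀ i j : Fin k, (tensorForm k hX hV).AdjointPair (perm G k X (Equiv.swap i j))
      (xiAll G k X * perm G k X (Equiv.swap i j) * xiAll G k X) := by
    intro i j
    rw [xiAll_mul_perm, mul_assoc, xiAll_mul_self, mul_one]
    simpa using adjointPair_perm hX hV (Equiv.swap i j)
  cases g with
  | t i j h =>
    rw [genOp, mul_smul_comm, smul_mul_assoc]
    exact (hperm i j).real_smul _
  | e i j h =>
    -- Eliminates the contraction in favour of the swap and `Ω`, whose adjoints are already known.
    have h1 : contraction G k X i j =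
        (G.eps : ℂ) • (perm G k X (Equiv.swap i j) + ((-1 : ℝ) : ℂ) • M.omega k (some i) j) := by
      rw [M.omega_some (succ_ne h)]
      exact eq_smul_add_neg_smul_sub G.epsC_mul_epsC _ _
    have h2 : some i ≠ some j := fun h' => succ_ne h (Option.some.inj h')
    rw [genOp, h1, mul_smul_comm, smul_mul_assoc, mul_add, add_mul, mul_smul_comm, smul_mul_assoc]
    exact ((hperm i j).add ((hI.adjointPair_omega hC h2).real_smul _)).real_smul _
  | z i =>
    rw [genOp, zOp, mul_smul_comm, smul_mul_assoc, mul_add, add_mul, mul_smul_comm,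
      smul_mul_assoc, mul_one, xiAll_mul_self, Finset.mul_sum, Finset.sum_mul]
    refine (SesqForm.AdjointPair.add (.sum _ fun s hs => ?_)
      (SesqForm.AdjointPair.one.real_smul _)).real_smul _
    -- Only factors strictly to the left of `i` occur in `z_i`, so the two legs of each `Ω` are on
    -- distinct factors.
    exact hI.adjointPair_omega hC (ne_of_mem_leftOf hs le_rfl)
  | theta i =>
    rw [genOp, xiAll_conj_site, xi_mul_xi, Matrix.one_mul]
    exact adjointPair_site hX hC.xi i

/-! ### From generators to the whole algebra -/

theorem action_w₀ {W : Set (ℕ × ℝ)} (hW : M.Satisfies k W) :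
    M.action hW VWAlgebra.w₀ = xiAll G k X := by
  rw [VWAlgebra.w₀, map_list_prod, List.map_ofFn, ← prod_site_xi]
  congr 2
  ext1 i
  exact M.action_gen hW _

theorem action_starOp {W : Set (ℕ × ℝ)} (hW : M.Satisfies k W) (b : G.VW k W) :
    M.action hW (VWAlgebra.starOp b) =
      xiAll G k X * M.action hW (VWAlgebra.bullet b).out * xiAll G k X := by
  rw [VWAlgebra.starOp, map_mul, map_mul, action_w₀]

variable {M} in
-- Being an adjoint pair is compatible with sums, with scalars up to conjugation, and with products
-- in reversed order. The star operation has the same three properties, so induction over the free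
-- algebra reduces the claim to generators.
theorem IsInvariant.adjointPair_action (hI : M.IsInvariant hX) (hC : G.IsCompatible hV)
    {W : Set (ℕ × ℝ)} (hW : M.Satisfies k W) (b : G.VW k W) :
    (tensorForm k hX hV).AdjointPair (M.action hW b) (M.action hW (VWAlgebra.starOp b)) := by
  rw [action_starOp]
  obtain ⟨a, rfl⟩ := RingQuot.mkAlgHom_surjective ℂ _ b
  induction a using FreeAlgebra.induction with
  | grade0 r =>
    -- Scalars act on `ConjOp` through conjugation, so `•` sends `r` to its conjugate.
    have h : (VWAlgebra.bullet (algebraMap ℂ (G.VW k W) r)).out = conj r • (1 : G.VW k W) := by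
      rw [Algebra.algebraMap_eq_smul_one, map_smul, ConjOp.out_smul, map_one]
      rfl
    rw [AlgHom.commutes, AlgHom.commutes, h, map_smul, map_one, Algebra.algebraMap_eq_smul_one,
      mul_smul_comm, smul_mul_assoc, mul_one, xiAll_mul_self]
    exact SesqForm.AdjointPair.one.smul r
  | grade1 g =>
    change (tensorForm k hX hV).AdjointPair (M.action hW (VWAlgebra.gen g))
      (xiAll G k X * M.action hW (VWAlgebra.bullet (VWAlgebra.gen g)).out * xiAll G k X)
    rw [VWAlgebra.bullet_gen, action_gen]
    exact hI.adjointPair_genOp hC g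
  | mul a b ha hb =>
    convert ha.mul hb using 1
    · rw [map_mul, map_mul]
    · rw [map_mul, map_mul, ConjOp.out_mul, map_mul]
      generalize M.action hW (VWAlgebra.bullet _).out = A
      generalize M.action hW (VWAlgebra.bullet _).out = B
      -- Conjugation by `xiAll` is multiplicative once the `1` between the factors is written as its
      -- square.
      calc _ = xiAll G k X * A * 1 * B * xiAll G k X := by noncomm_ring
        _ = _ := by rw [← xiAll_mul_self]; noncomm_ring
  | add a b ha hb =>
    convert ha.add hb using 1
    · rw [map_add, map_add]
    · rw [map_add, map_add, ConjOp.out_add, map_add, mul_add, add_mul]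

theorem functorForm_isHermitian (μ : G.K →* ℂˣ) (h : hX.IsHermitian) (h' : hV.IsHermitian) :
    (M.functorForm k μ hX hV).IsHermitian := fun φ ψ =>
  tensorForm_isHermitian h h' (φ.1 1) (ψ.1 1)

end GKModule

/-! ### The standard form and positivity -/

namespace ClassicalGroup

variable (G : ClassicalGroup) {k : ℕ} {X : Type*} [AddCommGroup X] [Module ℂ X]

/-- The standard Hermitian form on `V = ℂ^N`. -/
noncomputable def stdForm : SesqForm G.StdMod :=
  LinearMap.mk₂'ₛₗ (RingHom.id ℂ) (starRingEnd ℂ) (fun v w => v ⬝ᵥ star w)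
    (fun v v' w => add_dotProduct v v' (star w)) (fun c v w => smul_dotProduct c v (star w))
    (fun v w w' => by rw [star_add, dotProduct_add])
    (fun c v w => by rw [star_smul, dotProduct_smul]; rfl)

theorem stdForm_apply (v w : G.StdMod) : G.stdForm v w = v ⬝ᵥ star w := rfl

theorem stdForm_isHermitian : G.stdForm.IsHermitian := fun v w => by
  simp [stdForm_apply, dotProduct, mul_comm]

theorem stdForm_real_mulVec (A : Matrix G.Idx G.Idx ℝ) (v w : G.StdMod) :
    G.stdForm (A.map Complex.ofRealHom *ᵥ v) w = G.stdForm v (Aᵀ.map Complex.ofRealHom *ᵥ w) := by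
  have h : (Aᵀ.map Complex.ofRealHom)ᴴ = A.map Complex.ofRealHom := by ext; simp
  rw [stdForm_apply, stdForm_apply, Matrix.star_mulVec, h, dotProduct_comm, dotProduct_mulVec,
    dotProduct_comm]

-- For the standard form the adjoint of a real matrix is its transpose. Elements of `K` are
-- orthogonal and those of `𝔭₀` are symmetric; non-degeneracy follows by pairing a vector with
-- itself.
open scoped ComplexOrder in
theorem stdForm_isCompatible : G.IsCompatible G.stdForm := by
  refine ⟨fun v hv => dotProduct_self_star_eq_zero.1 (hv v), fun κ v w => ?_, fun P hP v w => ?_⟩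
  · rw [← cmat_transpose]
    exact G.stdForm_real_mulVec _ v w
  · rw [G.stdForm_real_mulVec, hP.2]

variable {G}

/-- The standard basis of `V` splits `X ⊗ V^{⊗k}` into copies of `X` indexed by multi-indices `f`.
Only existence of such coordinates is needed for positivity. -/
theorem exists_eq_sum_tmul_single (u : G.TensorSpace k X) : ∃ x : (Fin k → G.Idx) → X,
    u = ∑ f, x f ⊗ₜ PiTensorProduct.tprod ℂ fun i => (Pi.single (f i) 1 : G.StdMod) := by
  induction u using tensorSpace_induction with
  | add u w hu hw =>
    obtain ⟨x, rfl⟩ := hu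
    obtain ⟨y, rfl⟩ := hw
    exact ⟨x + y, by simp only [Pi.add_apply, TensorProduct.add_tmul, Finset.sum_add_distrib]⟩
  | tmul x v =>
    -- The coefficients come from expanding every `v i` in the standard basis and using
    -- multilinearity.
    refine ⟨fun f => (∏ i, v i (f i)) • x, ?_⟩
    have h : v = fun i => ∑ a, v i a • (Pi.single a 1 : G.StdMod) := by
      ext i a
      simp [Finset.sum_apply, Pi.single_apply]
    conv_lhs => rw [h, MultilinearMap.map_sum, TensorProduct.tmul_sum]
    refine Finset.sum_congr rfl fun f _ => ?_
    rw [MultilinearMap.map_smul_univ, TensorProduct.smul_tmul]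

theorem stdForm_single (a b : G.Idx) :
    G.stdForm (Pi.single a 1) (Pi.single b 1) = if a = b then 1 else 0 := by
  rw [stdForm_apply, single_dotProduct, one_mul]
  simp [Pi.single_apply]

/-- The copies of `X` are mutually orthogonal since the standard basis is orthonormal. Thus `⟨u, u⟩`
is the sum of the `⟨x_f, x_f⟩`, and some coordinate of a nonzero `u` is nonzero. -/
theorem tensorForm_stdForm_isPosDef {hX : SesqForm X} (h : hX.IsPosDef) :
    (tensorForm k hX G.stdForm).IsPosDef := by
  refine ⟨tensorForm_isHermitian h.1 G.stdForm_isHermitian, fun u hu => ?_⟩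
  obtain ⟨x, rfl⟩ := exists_eq_sum_tmul_single u
  have h1 : tensorForm k hX G.stdForm
      (∑ f, x f ⊗ₜ PiTensorProduct.tprod ℂ fun i => (Pi.single (f i) 1 : G.StdMod))
      (∑ f, x f ⊗ₜ PiTensorProduct.tprod ℂ fun i => (Pi.single (f i) 1 : G.StdMod)) =
      ∑ f, hX (x f) (x f) := by
    simp only [map_sum, LinearMap.sum_apply, tensorForm_tmul, stdForm_single]
    refine Finset.sum_congr rfl fun f _ => ?_
    rw [Finset.sum_eq_single f]
    · simp
    · intro g _ hg
      -- Distinct multi-indices differ at some site, and the factor of the product at that site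
      -- vanishes.
      obtain ⟨i, hi⟩ := Function.ne_iff.1 hg
      rw [Finset.prod_eq_zero (Finset.mem_univ i), mul_zero]
      simp [hi]
    · simp
  have h2 : ∃ f, x f ≠ 0 := by
    by_contra! h0
    exact hu (by simp [h0])
  have h3 : ∀ y, 0 ≤ (hX y y).re := fun y => by
    by_cases hy : y = 0
    · simp [hy]
    · exact (h.2 y hy).le
  obtain ⟨f, hf⟩ := h2
  rw [h1, Complex.re_sum]
  exact Finset.sum_pos' (fun f _ => h3 _) ⟨f, Finset.mem_univ f, h.2 _ hf⟩

end ClassicalGroup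

theorem mainTheorem6 (G : ClassicalGroup) {X : Type*} [AddCommGroup X] [Module ℂ X]
    (M : GKModule G X) (k : ℕ) (W : Set (ℕ × ℝ)) (hW : M.Satisfies k W) (μ : G.K →* ℂˣ) :
    (∃ hV : SesqForm G.StdMod, hV.IsHermitian ∧ G.IsCompatible hV) ∧
    (∀ hV : SesqForm G.StdMod, G.IsCompatible hV →
      ∀ hX : SesqForm X, M.IsInvariant hX →
        M.IsFunctorInvariant hW μ (M.functorForm k μ hX hV) ∧
          (hV.IsHermitian → hX.IsHermitian → (M.functorForm k μ hX hV).IsHermitian)) ∧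
    (M.IsUnitary → M.IsFunctorUnitary hW μ) := by
  -- Evaluation at `1` intertwines the two actions and carries the induced form to the product form,
  -- so the adjointness on `X ⊗ V^{⊗k}` specialises directly.
  have hinv : ∀ hV : SesqForm G.StdMod, G.IsCompatible hV → ∀ hX : SesqForm X,
      M.IsInvariant hX → M.IsFunctorInvariant hW μ (M.functorForm k μ hX hV) :=
    fun hV hC hX hI b φ ψ => hI.adjointPair_action hC hW b (φ.1 1) (ψ.1 1)
  refine ⟨⟨G.stdForm, G.stdForm_isHermitian, G.stdForm_isCompatible⟩, fun hV hC hX hI =>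
    ⟨hinv hV hC hX hI, fun h h' => M.functorForm_isHermitian μ h' h⟩, ?_⟩
  rintro ⟨hX, hP, hI⟩
  refine ⟨M.functorForm k μ hX G.stdForm,
    ⟨M.functorForm_isHermitian μ hP.1 G.stdForm_isHermitian, fun φ hφ => ?_⟩,
    hinv _ G.stdForm_isCompatible hX hI⟩
  -- A linear map out of `ℂ` is determined by its value at `1`, so `φ(1)` is nonzero and positivity
  -- upstairs applies to it.
  refine (ClassicalGroup.tensorForm_stdForm_isPosDef hP).2 (φ.1 1) fun h0 => hφ ?_
  exact Subtype.ext (LinearMap.ext_ring h0)
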